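/- Let $m\ge 3$ be an integer, let $S^1=\mathbb R/\mathbb Z$, and let $M$ be a nonempty compact smooth Riemannian manifold without boundary, of dimension $n\ge 1$. Put $X=S^1\times M$, and let $\mathcal C(M)$ be the space of all skew products $$F\colon X\to X,\qquad F(\varphi,x)=(m\varphi,\ f_\varphi(x)),$$ where every $f_\varphi$ is a $C^1$-diffeomorphism of $M$ and $f_\varphi$ depends continuously on $\varphi\in S^1$ in the $C^0$ topology. Equip $\mathcal C(M)$ with the topology of the distance $\operatorname{dist}(F,G)=\sup_{\varphi}\max\{\operatorname{dist}_{C^1}(f_\varphi,g_\varphi),\operatorname{dist}_{C^1}(f_\varphi^{-1},g_\varphi^{-1})\}\in[0,\infty]$. Here points and tangent vectors of $M$ are compared by means of an arbitrary fixed smooth embedding $e\colon M\to\mathbb R^N$: $\operatorname{dist}_{C^1}(f,g)=\sup_{x}|e(f(x))-e(g(x))|+\sup_{x}\|D(e\circ f)(x)-D(e\circ g)(x)\|$. A region is the closure of a nonempty connected open set. A compact set $D\subset X$ is trapping for $F$ if $F(D)\subset\operatorname{int}D$; its maximal attractor is $A_{\max}=\bigcap_{k\ge 0}F^k(D)$.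 An $F$-invariant probability measure $\mu$ on $X$ is an SRB measure if some measurable set of positive Lebesgue measure is contained in its basin $E(\mu)$, the set of all $x\in X$ with $\frac1k\sum_{i=0}^{k-1}\psi(F^i(x))\to\int_X\psi\,d\mu$ for every $\psi\in C(X)$. The map $F$ has a massive attractor if there is a trapping region $D$ whose maximal attractor $A_{\max}$ satisfies: $A_{\max}\ne X$; $A_{\max}$ is a region; and $A_{\max}$ is the support of an ergodic $F$-invariant SRB measure $\mu$ whose basin $E(\mu)$ contains Lebesgue-almost every point of $D$. Then there exists a nonempty open subset $\mathcal O\subset\mathcal C(M)$ such that every skew product $F\in\mathcal O$ has a massive attractor. -/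

import Mathlib

open MeasureTheory Filter Topology Manifold
open scoped ContDiff ENNReal

noncomputable section

namespace MassiveAttractor

/-! ### Trapping sets and maximal attractors -/

section Topological

variable {X : Type*} [TopologicalSpace X]

/-- A *region* is the closure of a nonempty connected open set (`IsConnected` includes being
nonempty). -/
def IsRegion (A : Set X) : Prop :=
  ∃ U : Set X, IsOpen U ∧ IsConnected U ∧ A = closure U

/-- A compact set `D` is *trapping* for `F` if `F(D)` lies in the interior of `D`. -/
def IsTrapping (F : X → X) (D : Set X) : Prop :=
  IsCompact D ∧ F '' D ⊆ interior D

/-- The maximal attractor `⋂ₙ Fⁿ(D)` in `D`. -/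
def maximalAttractor (F : X → X) (D : Set X) : Set X :=
  ⋂ k : ℕ, F^[k] '' D

/-- The points whose time averages of every continuous function converge to its integral with
respect to `μ`. -/
def statBasin [MeasurableSpace X] (F : X → X) (μ : Measure X) : Set X :=
  {x | ∀ ψ : C(X, ℝ),
    Tendsto (fun k : ℕ => birkhoffAverage ℝ F ψ k x) atTop (𝓝 (∫ y, ψ y ∂μ))}

end Topological

section Manifold

variable {n : ℕ} {M : Type*} [TopologicalSpace M] [ChartedSpace (EuclideanSpace ℝ (Fin n)) M]

/-- A subset of the manifold `S¹ × M` is *Lebesgue null* if it has measure zero in the coordinates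
given by each (preferred) chart of `M` together with the identity of `S¹ = ℝ / ℤ`.  These are the
sets of measure zero for the Riemannian volume of any Riemannian metric on `S¹ × M`. -/
def LebesgueNull (n : ℕ) {M : Type*} [TopologicalSpace M]
    [ChartedSpace (EuclideanSpace ℝ (Fin n)) M] (E : Set (UnitAddCircle × M)) : Prop :=
  ∀ p : M, (volume : Measure (UnitAddCircle × EuclideanSpace ℝ (Fin n)))
    {z | z.2 ∈ (chartAt (EuclideanSpace ℝ (Fin n)) p).target ∧
      (z.1, (chartAt (EuclideanSpace ℝ (Fin n)) p).symm z.2) ∈ E} = 0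

/-- `μ` is a Sinai-Ruelle-Bowen measure for `F`: an invariant probability measure such that some
measurable set of positive Lebesgue measure consists of points whose time averages converge to
the averages with respect to `μ`. -/
def IsSRB (n : ℕ) {M : Type*} [TopologicalSpace M] [ChartedSpace (EuclideanSpace ℝ (Fin n)) M]
    [MeasurableSpace M] (F : UnitAddCircle × M → UnitAddCircle × M)
    (μ : Measure (UnitAddCircle × M)) : Prop :=
  IsProbabilityMeasure μ ∧ MeasurePreserving F μ μ ∧
    ∃ E : Set (UnitAddCircle × M), MeasurableSet E ∧ ¬ LebesgueNull n E ∧ E ⊆ statBasin F μ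

/-- The maximal attractor of `F` in the trapping region `D` is *massive*: it is not the whole
space, it is a region, and it is the support of an ergodic invariant SRB measure whose basin
contains Lebesgue almost every point of `D`. -/
def IsMassive (n : ℕ) {M : Type*} [TopologicalSpace M]
    [ChartedSpace (EuclideanSpace ℝ (Fin n)) M] [MeasurableSpace M]
    (F : UnitAddCircle × M → UnitAddCircle × M) (D : Set (UnitAddCircle × M)) : Prop :=
  maximalAttractor F D ≠ Set.univ ∧
  IsRegion (maximalAttractor F D) ∧
  ∃ μ : Measure (UnitAddCircle × M), IsSRB n F μ ∧ Ergodic F μ ∧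
    μ.support = maximalAttractor F D ∧ LebesgueNull n (D \ statBasin F μ)

/-- `F` has a massive attractor. -/
def HasMassiveAttractor (n : ℕ) {M : Type*} [TopologicalSpace M]
    [ChartedSpace (EuclideanSpace ℝ (Fin n)) M] [MeasurableSpace M]
    (F : UnitAddCircle × M → UnitAddCircle × M) : Prop :=
  ∃ D : Set (UnitAddCircle × M), IsRegion D ∧ IsTrapping F D ∧ IsMassive n F D

/-! ### Skew products -/

/-- The fiber maps of a skew product over a self-map of the circle with fiber `M`: a family
`f_φ`, `φ ∈ S¹`, of `C¹` diffeomorphisms of `M`, depending continuously on `φ` in the `C⁰`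
topology, i.e. with `(φ, x) ↦ f_φ(x)` continuous.  (For a closed manifold `M`, a `C¹`
diffeomorphism of `M` onto its image is the same as a `C¹` diffeomorphism of `M`.) -/
structure SkewProduct (n : ℕ) (M : Type*) [TopologicalSpace M]
    [ChartedSpace (EuclideanSpace ℝ (Fin n)) M] where
  fiber : UnitAddCircle → Diffeomorph (𝓡 n) (𝓡 n) M M 1
  continuous_fiber : Continuous fun p : UnitAddCircle × M => fiber p.1 p.2

/-- The skew product `(φ, x) ↦ (m φ, f_φ(x))` over the linear expanding circle map. -/
def SkewProduct.toMap (m : ℕ) (F : SkewProduct n M) (p : UnitAddCircle × M) :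
    UnitAddCircle × M :=
  (m • p.1, F.fiber p.1 p.2)

/-- The `C¹` distance between two maps `f₁ f₂ : M → M`.  Here `e : M → ℝᴺ` is an embedding of `M`
used to compare points and tangent vectors of `M`, and the size of the derivatives is measured
with the Riemannian metric `g` of `M`. The value is
`sup ‖e (f₁ x) - e (f₂ x)‖ + sup ‖D (e ∘ f₁) x v - D (e ∘ f₂) x v‖`,
where the suprema range over all points `x`, resp. over all tangent vectors `v` at `x` of length
at most one. -/
def c1Dist [IsManifold (𝓡 n) ∞ M] {N : ℕ}
    (g : Bundle.ContMDiffRiemannianMetric (𝓡 n) ∞ (EuclideanSpace ℝ (Fin n))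
      (fun x : M => TangentSpace (𝓡 n) x))
    (e : M → EuclideanSpace ℝ (Fin N)) (f₁ f₂ : M → M) : ℝ≥0∞ :=
  (⨆ x : M, edist (e (f₁ x)) (e (f₂ x))) +
  ⨆ (x : M) (v : TangentSpace (𝓡 n) x) (_ : g.inner x v v ≤ 1),
    edist (mvfderiv (𝓡 n) (e ∘ f₁) x v) (mvfderiv (𝓡 n) (e ∘ f₂) x v)

section metric

variable [IsManifold (𝓡 n) ∞ M] {N : ℕ}
    (g : Bundle.ContMDiffRiemannianMetric (𝓡 n) ∞ (EuclideanSpace ℝ (Fin n))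
      (fun x : M => TangentSpace (𝓡 n) x))
    (e : M → EuclideanSpace ℝ (Fin N))

theorem c1Dist_self (f : M → M) : c1Dist g e f f = 0 := by
  simp [c1Dist]

theorem c1Dist_comm (f₁ f₂ : M → M) : c1Dist g e f₁ f₂ = c1Dist g e f₂ f₁ := by
  simp only [c1Dist, edist_comm]

theorem c1Dist_triangle (f₁ f₂ f₃ : M → M) :
    c1Dist g e f₁ f₃ ≤ c1Dist g e f₁ f₂ + c1Dist g e f₂ f₃ := by
  unfold c1Dist
  rw [add_add_add_comm]
  refine add_le_add (iSup_le fun x => ?_) (iSup_le fun x => iSup_le fun v => iSup_le fun hv => ?_)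
  · exact (edist_triangle _ (e (f₂ x)) _).trans (add_le_add
      (le_iSup (fun x : M => edist (e (f₁ x)) (e (f₂ x))) x)
      (le_iSup (fun x : M => edist (e (f₂ x)) (e (f₃ x))) x))
  · exact (edist_triangle _ (mvfderiv (𝓡 n) (e ∘ f₂) x v) _).trans (add_le_add
      (le_iSup_of_le x (le_iSup_of_le v (le_iSup_of_le hv le_rfl)))
      (le_iSup_of_le x (le_iSup_of_le v (le_iSup_of_le hv le_rfl))))

/-- The distance `sup_φ dist_{C¹}(f_φ^{±1}, g_φ^{±1})` on the space of skew products.  (It separates points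
when `e` is injective, and it may take the value `∞`.) -/
abbrev SkewProduct.c1Metric : PseudoEMetricSpace (SkewProduct n M) where
  edist F G := ⨆ φ : UnitAddCircle, max (c1Dist g e (F.fiber φ) (G.fiber φ))
    (c1Dist g e (F.fiber φ).symm (G.fiber φ).symm)
  edist_self F := by simp [c1Dist_self]
  edist_comm F G := by
    simp only [c1Dist_comm g e (F.fiber _), c1Dist_comm g e (F.fiber _).symm]
  edist_triangle F G H := by
    refine iSup_le fun φ => max_le ?_ ?_
    · exact (c1Dist_triangle g e _ (G.fiber φ) _).trans (add_le_add
        (le_iSup_of_le φ (le_max_left _ _)) (le_iSup_of_le φ (le_max_left _ _)))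
    · exact (c1Dist_triangle g e _ (G.fiber φ).symm _).trans (add_le_add
        (le_iSup_of_le φ (le_max_right _ _)) (le_iSup_of_le φ (le_max_right _ _)))

/-- The topology on the space of skew products given by the distance `SkewProduct.c1Metric`. -/
abbrev SkewProduct.c1Topology : TopologicalSpace (SkewProduct n M) :=
  (SkewProduct.c1Metric g e).toUniformSpace.toTopologicalSpace

end metric

end Manifold

end MassiveAttractor

end

/-!
A skew product has a massive attractor as soon as it contracts the fibers over a compact set `B` of
`M` into the interior of `B` and some cylinder `S¹ × W₀`, with `W₀ ⊆ B` open and connected, is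
covered by its images under the iterates and meets its first image
(`IsContractingSkew.hasMassiveAttractor`; `B` is a region other than `M`). The covering puts the
cylinder into the maximal attractor, and since the fibers are contracted, the images of the
cylinder are dense in the attractor; so the attractor is the closure of the union of these
images, a region. The images of Lebesgue measure on a horizontal circle converge to an invariant
measure whose support is the attractor. Almost every point of the circle has an equidistributed
orbit under `φ ↦ m φ`, and by contraction the time averages of a point of `S¹ × B` depend only on
its base point, so that almost every point of `S¹ × B` lies in the basin; this also gives
ergodicity.

Contraction and covering of a compact set by the images of an open one are both open conditions in
the `C¹` topology (`AffineChart.eventually_isContractingSkew`,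
`SkewProduct.eventually_exists_back_mem`), so it suffices to find one skew product for which both
hold, the second in the stronger form that the closed cylinder over a ball is covered by the images
of the open one. In coordinates its fiber maps are the affine contractions `x ↦ (1 - ε) x + ε c(φ)`
on the unit ball, cut off to the identity further out. For small `ε` each step moves the points
very little, and what matters for covering is that from every point near the centre one can steer
backwards towards the centre by a suitable choice of preimages in the circle
(`exists_push_covering`). This is possible if the continuous curve `c` lies in no hyperplane and
has sum zero over the `m` preimages of each point (`exists_meanZero_curve`): if no backward orbit
of a point had a positive sum of `⟪u, c⟫`, all of these sums would vanish, since they average to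
zero, and `c` would be orthogonal to `u` on a dense set (`exists_inner_sum_pos`).

The coordinates are chosen to be affine functions of the embedding `e` (`AffineChart`), so that the
derivative of a map in these coordinates is a fixed linear function of the derivative of its
composition with `e`, by which the `C¹` distance is defined.
-/

namespace MassiveAttractor

/-! ### Equidistribution of the orbits of `φ ↦ m φ` -/

section Equidistribution

open ComplexConjugate

theorem integral_norm_sq_sum_le_of_orthogonal {Ω : Type*} [MeasurableSpace Ω] {μ : Measure Ω}
    [IsProbabilityMeasure μ] {X : ℕ → Ω → ℂ} (hm : ∀ i, Measurable (X i))
    (hb : ∀ i w, ‖X i w‖ ≤ 1) (ho : ∀ i j, i < j → ∫ w, conj (X i w) * X j w ∂μ = 0) (k : ℕ) :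
    ∫ w, ‖∑ i ∈ Finset.range k, X i w‖ ^ 2 ∂μ ≤ k := by
  have hSm : ∀ k, Measurable fun w => ∑ i ∈ Finset.range k, X i w := fun k =>
    Finset.measurable_sum _ fun i _ => hm i
  have hSb : ∀ k w, ‖∑ i ∈ Finset.range k, X i w‖ ≤ k := fun k w =>
    (norm_sum_le _ _).trans ((Finset.sum_le_sum fun i _ => hb i w).trans (by simp))
  have hXX : ∀ i j, Integrable (fun w => conj (X i w) * X j w) μ := fun i j =>
    Integrable.of_bound (((Complex.continuous_conj.measurable.comp (hm i)).mul
      (hm j)).aestronglyMeasurable) 1 (ae_of_all _ fun w => by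
        rw [norm_mul, RCLike.norm_conj]; exact mul_le_one₀ (hb i w) (norm_nonneg _) (hb j w))
  induction k with
  | zero => simp
  | succ k ih =>
    have hcross : ∫ w, conj (∑ i ∈ Finset.range k, X i w) * X k w ∂μ = 0 := by
      simp only [map_sum, Finset.sum_mul]
      rw [integral_finsetSum _ fun i _ => hXX i k]
      exact Finset.sum_eq_zero fun i hi => ho i k (Finset.mem_range.1 hi)
    have hcrossI : Integrable (fun w => conj (∑ i ∈ Finset.range k, X i w) * X k w) μ := by
      simp only [map_sum, Finset.sum_mul]
      exact integrable_finsetSum _ fun i _ => hXX i k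
    have hpt : ∀ w, ‖∑ i ∈ Finset.range (k + 1), X i w‖ ^ 2 =
        ‖∑ i ∈ Finset.range k, X i w‖ ^ 2 +
          (2 * (conj (∑ i ∈ Finset.range k, X i w) * X k w).re + ‖X k w‖ ^ 2) := by
      intro w
      rw [Finset.sum_range_succ, ← Complex.normSq_eq_norm_sq, ← Complex.normSq_eq_norm_sq,
        ← Complex.normSq_eq_norm_sq, Complex.normSq_add]
      have : (conj (∑ i ∈ Finset.range k, X i w) * X k w).re =
          ((∑ i ∈ Finset.range k, X i w) * conj (X k w)).re := by
        simp only [Complex.mul_re, Complex.conj_re, Complex.conj_im]; ring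
      rw [this]; ring
    have hI1 : Integrable (fun w => ‖∑ i ∈ Finset.range k, X i w‖ ^ 2) μ :=
      Integrable.of_bound ((hSm k).norm.pow_const 2).aestronglyMeasurable ((k : ℝ) ^ 2)
        (ae_of_all _ fun w => by
          rw [Real.norm_of_nonneg (by positivity)]
          exact pow_le_pow_left₀ (norm_nonneg _) (hSb k w) 2)
    have hI2 : Integrable (fun w => 2 * (conj (∑ i ∈ Finset.range k, X i w) * X k w).re) μ :=
      hcrossI.re.const_mul 2
    have hI3 : Integrable (fun w => ‖X k w‖ ^ 2) μ :=
      Integrable.of_bound ((hm k).norm.pow_const 2).aestronglyMeasurable 1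
        (ae_of_all _ fun w => by
          rw [Real.norm_of_nonneg (by positivity)]
          exact pow_le_one₀ (norm_nonneg _) (hb k w))
    have h3 : ∫ w, ‖X k w‖ ^ 2 ∂μ ≤ 1 := by
      calc ∫ w, ‖X k w‖ ^ 2 ∂μ ≤ ∫ _, (1 : ℝ) ∂μ :=
            integral_mono hI3 (integrable_const 1) fun w => pow_le_one₀ (norm_nonneg _) (hb k w)
        _ = 1 := by simp
    have h2 : ∫ w, 2 * (conj (∑ i ∈ Finset.range k, X i w) * X k w).re ∂μ = 0 := by
      rw [integral_const_mul]
      have : ∫ w, (conj (∑ i ∈ Finset.range k, X i w) * X k w).re ∂μ = 0 := by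
        have := integral_re hcrossI
        rw [hcross] at this
        simpa using this
      rw [this, mul_zero]
    have hsum : ∫ w, ‖∑ i ∈ Finset.range (k + 1), X i w‖ ^ 2 ∂μ =
        ∫ w, ‖∑ i ∈ Finset.range k, X i w‖ ^ 2 ∂μ + (0 + ∫ w, ‖X k w‖ ^ 2 ∂μ) := by
      rw [integral_congr_ae (ae_of_all _ hpt), ← h2, ← integral_add hI2 hI3]
      exact integral_add hI1 (hI2.add hI3)
    rw [hsum]; push_cast; linarith

/-- A strong law of large numbers for bounded orthogonal functions: the averages tend to zero
almost everywhere along the squares, by summability of the second moments, and between two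
consecutive squares they change little. -/
theorem ae_tendsto_average_of_orthogonal {Ω : Type*} [MeasurableSpace Ω] {μ : Measure Ω}
    [IsProbabilityMeasure μ] {X : ℕ → Ω → ℂ} (hm : ∀ i, Measurable (X i))
    (hb : ∀ i w, ‖X i w‖ ≤ 1) (ho : ∀ i j, i < j → ∫ w, conj (X i w) * X j w ∂μ = 0) :
    ∀ᵐ w ∂μ, Tendsto (fun k : ℕ => (k : ℝ)⁻¹ * ‖∑ i ∈ Finset.range k, X i w‖) atTop (𝓝 0) := by
  set S : ℕ → Ω → ℂ := fun k w => ∑ i ∈ Finset.range k, X i w with hS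
  have hSm : ∀ k, Measurable (S k) := fun k => Finset.measurable_sum _ fun i _ => hm i
  have hSb : ∀ k w, ‖S k w‖ ≤ k := fun k w =>
    (norm_sum_le _ _).trans ((Finset.sum_le_sum fun i _ => hb i w).trans (by simp))
  -- the squares of the averages over `j ^ 2` terms have a summable series of integrals
  have hY : ∀ᵐ w ∂μ, ∑' j : ℕ, ENNReal.ofReal ((‖S (j ^ 2) w‖ / (j : ℝ) ^ 2) ^ 2) < ⊤ := by
    refine ae_lt_top' ?_ ?_
    · exact (Measurable.tsum fun j =>
        (((hSm _).norm.div_const _).pow_const 2).ennreal_ofReal).aemeasurable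
    rw [lintegral_tsum fun j =>
      (((hSm _).norm.div_const _).pow_const 2).ennreal_ofReal.aemeasurable]
    have hj : ∀ j : ℕ, ∫⁻ w, ENNReal.ofReal ((‖S (j ^ 2) w‖ / (j : ℝ) ^ 2) ^ 2) ∂μ ≤
        ENNReal.ofReal (1 / (j : ℝ) ^ 2) := by
      intro j
      have hint : Integrable (fun w => (‖S (j ^ 2) w‖ / (j : ℝ) ^ 2) ^ 2) μ := by
        refine Integrable.of_bound
          (((hSm _).norm.div_const _).pow_const 2).aestronglyMeasurable 1 (ae_of_all _ fun w => ?_)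
        rw [Real.norm_of_nonneg (by positivity)]
        refine pow_le_one₀ (by positivity) (div_le_one_of_le₀ ?_ (by positivity))
        exact_mod_cast hSb (j ^ 2) w
      rw [← ofReal_integral_eq_lintegral_ofReal hint (ae_of_all _ fun w => by positivity)]
      refine ENNReal.ofReal_le_ofReal ?_
      simp only [div_pow]
      rw [integral_div]
      have := integral_norm_sq_sum_le_of_orthogonal hm hb ho (j ^ 2)
      rcases Nat.eq_zero_or_pos j with rfl | hj
      · simp
      have hj' : (0 : ℝ) < j := by exact_mod_cast hj
      rw [div_le_div_iff₀ (by positivity) (by positivity)]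
      push_cast at this
      nlinarith [pow_pos hj' 2]
    refine ((ENNReal.tsum_le_tsum hj).trans_lt ?_).ne
    exact (Real.summable_one_div_nat_pow.2 one_lt_two).tsum_ofReal_lt_top
  filter_upwards [hY] with w hw
  have h1 : Tendsto (fun j : ℕ => ‖S (j ^ 2) w‖ / (j : ℝ) ^ 2) atTop (𝓝 0) := by
    have h := ENNReal.tendsto_cofinite_zero_of_tsum_ne_top hw.ne
    rw [Nat.cofinite_eq_atTop] at h
    have h' := (ENNReal.tendsto_toReal ENNReal.zero_ne_top).comp h
    have h'' : Tendsto (fun j : ℕ => (‖S (j ^ 2) w‖ / (j : ℝ) ^ 2) ^ 2) atTop (𝓝 0) := by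
      refine h'.congr fun j => ?_
      simp only [Function.comp]
      rw [ENNReal.toReal_ofReal (by positivity)]
    have h3 := h''.sqrt
    rw [Real.sqrt_zero] at h3
    exact h3.congr fun j => Real.sqrt_sq (by positivity)
  have hsq : Tendsto Nat.sqrt atTop atTop :=
    tendsto_atTop_atTop.2 fun b => ⟨b * b, fun a ha => Nat.le_sqrt.2 ha⟩
  have h2 : Tendsto (fun j : ℕ => ‖S (j ^ 2) w‖ / (j : ℝ) ^ 2 + 2 / (j : ℝ)) atTop (𝓝 0) := by
    simpa using h1.add (tendsto_const_div_atTop_nhds_zero_nat 2)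
  refine squeeze_zero' (Eventually.of_forall fun k => by positivity) ?_ (h2.comp hsq)
  filter_upwards [eventually_ge_atTop 1] with k hk
  -- between `j ^ 2` and `k` there are at most `2 * j` terms, each of norm at most one
  set j := Nat.sqrt k with hjdef
  have hj1 : j ^ 2 ≤ k := Nat.sqrt_le' k
  have hj2 : k ≤ j ^ 2 + 2 * j := by
    have := Nat.sqrt_le_add k
    rw [← hjdef] at this
    nlinarith
  have hj0 : 0 < j := Nat.sqrt_pos.2 hk
  have hj0' : (0 : ℝ) < j := by exact_mod_cast hj0
  have hdiff : ‖S k w‖ ≤ ‖S (j ^ 2) w‖ + 2 * j := by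
    have : S k w = S (j ^ 2) w + ∑ i ∈ Finset.Ico (j ^ 2) k, X i w :=
      (Finset.sum_range_add_sum_Ico _ hj1).symm
    rw [this]
    refine (norm_add_le _ _).trans (add_le_add le_rfl ?_)
    refine (norm_sum_le _ _).trans ((Finset.sum_le_sum fun i _ => hb i w).trans ?_)
    simp only [Finset.sum_const, Nat.card_Ico, nsmul_eq_mul, mul_one]
    exact_mod_cast (by omega : k - j ^ 2 ≤ 2 * j)
  have hk' : ((j : ℝ)) ^ 2 ≤ k := by exact_mod_cast hj1
  calc (k : ℝ)⁻¹ * ‖S k w‖ ≤ ((j : ℝ) ^ 2)⁻¹ * (‖S (j ^ 2) w‖ + 2 * j) := by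
        gcongr
    _ = ‖S (j ^ 2) w‖ / (j : ℝ) ^ 2 + 2 / (j : ℝ) := by field_simp

instance isProbabilityMeasure_unitAddCircle :
    IsProbabilityMeasure (volume : Measure UnitAddCircle) :=
  ⟨UnitAddCircle.measure_univ⟩

theorem volume_eq_haarAddCircle : (volume : Measure UnitAddCircle) = AddCircle.haarAddCircle := by
  simp [AddCircle.volume_eq_smul_haarAddCircle]

theorem integral_fourier_of_ne_zero {k : ℤ} (hk : k ≠ 0) :
    ∫ φ : UnitAddCircle, fourier k φ = 0 := by
  have h := congrFun (fourierCoeff_fourier (T := 1) k) 0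
  rw [Pi.single_eq_of_ne hk.symm] at h
  rw [volume_eq_haarAddCircle]
  simpa [fourierCoeff] using h

theorem iterate_nsmul_apply (m i : ℕ) (φ : UnitAddCircle) :
    (fun φ : UnitAddCircle => m • φ)^[i] φ = m ^ i • φ := by
  rw [smul_iterate]

/-- Lebesgue almost every point of the circle is equidistributed under `φ ↦ m φ`. -/
theorem ae_tendsto_birkhoffAverage_nsmul {m : ℕ} (hm : 2 ≤ m) :
    ∀ᵐ φ : UnitAddCircle, ∀ h : C(UnitAddCircle, ℂ),
      Tendsto (fun k => birkhoffAverage ℂ (fun φ : UnitAddCircle => m • φ) h k φ) atTop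
        (𝓝 (∫ θ, h θ)) := by
  have hchar : ∀ᵐ φ : UnitAddCircle, ∀ k : ℤ,
      Tendsto (fun j => birkhoffAverage ℂ (fun φ : UnitAddCircle => m • φ) (fourier k) j φ) atTop
        (𝓝 (∫ θ : UnitAddCircle, fourier k θ)) := by
    refine ae_all_iff.2 fun k => ?_
    rcases eq_or_ne k 0 with rfl | hk
    · refine Eventually.of_forall fun φ => ?_
      simp only [fourier_zero, integral_const, probReal_univ, one_smul]
      refine tendsto_const_nhds.congr' ?_
      filter_upwards [eventually_ge_atTop 1] with j hj
      have : (j : ℂ) ≠ 0 := by exact_mod_cast (by omega : j ≠ 0)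
      simp [birkhoffAverage, birkhoffSum, this]
    -- along orbits, the character of frequency `k` becomes the characters of frequencies
    -- `k * m ^ i`, which are pairwise distinct and hence orthogonal
    · have horth := ae_tendsto_average_of_orthogonal (μ := (volume : Measure UnitAddCircle))
        (X := fun i φ => fourier (k * (m : ℤ) ^ i) φ) (fun i => (fourier _).continuous.measurable)
        (fun i φ => by
          refine (ContinuousMap.norm_coe_le_norm _ φ).trans ?_
          rw [fourier_norm]) (fun i j hij => by
          simp_rw [← fourier_neg, ← fourier_add]
          refine integral_fourier_of_ne_zero ?_
          have : (m : ℤ) ^ i ≠ (m : ℤ) ^ j := by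
            exact_mod_cast (Nat.pow_lt_pow_right (by omega) hij).ne
          intro h
          apply this
          have : k * ((m : ℤ) ^ j - (m : ℤ) ^ i) = 0 := by linarith
          rcases mul_eq_zero.1 this with h | h
          · exact absurd h hk
          · linarith)
      filter_upwards [horth] with φ hφ
      rw [integral_fourier_of_ne_zero hk]
      refine tendsto_zero_iff_norm_tendsto_zero.2 (hφ.congr fun j => ?_)
      rw [birkhoffAverage, birkhoffSum, norm_smul]
      congr 1
      · simp
      · congr 1
        refine Finset.sum_congr rfl fun i _ => ?_
        rw [iterate_nsmul_apply, fourier_apply, fourier_apply, mul_smul]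
        norm_cast
  filter_upwards [hchar] with φ hφ
  have hspan : ∀ h ∈ Submodule.span ℂ (Set.range (fourier (T := 1))),
      Tendsto (fun j => birkhoffAverage ℂ (fun φ : UnitAddCircle => m • φ) h j φ) atTop
        (𝓝 (∫ θ : UnitAddCircle, h θ)) := by
    intro h hh
    have hint : ∀ f : C(UnitAddCircle, ℂ), Integrable f :=
      fun f => f.continuous.integrable_of_hasCompactSupport (HasCompactSupport.of_compactSpace _)
    induction hh using Submodule.span_induction with
    | mem x hx => obtain ⟨k, rfl⟩ := hx; exact hφ k
    | zero => simp [birkhoffAverage, birkhoffSum]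
    | add x y _ _ hx hy =>
      simp only [ContinuousMap.coe_add, Pi.add_apply]
      rw [integral_add (hint x) (hint y)]
      refine (hx.add hy).congr fun j => ?_
      simp [birkhoffAverage, birkhoffSum, Finset.sum_add_distrib, mul_add]
    | smul a x _ hx =>
      simp only [ContinuousMap.coe_smul, Pi.smul_apply]
      rw [integral_smul]
      refine (hx.const_smul a).congr fun j => ?_
      simp only [birkhoffAverage, birkhoffSum, Pi.smul_apply, smul_eq_mul, ← Finset.mul_sum]
      ring
  -- trigonometric polynomials are uniformly dense
  intro h
  have hcl : h ∈ closure (Submodule.span ℂ (Set.range (fourier (T := 1))) : Set _) := by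
    have := span_fourier_closure_eq_top (T := 1)
    rw [← Submodule.topologicalClosure_coe, this]; trivial
  have hb : ∀ f : C(UnitAddCircle, ℂ), ∀ j, ‖birkhoffAverage ℂ
      (fun φ : UnitAddCircle => m • φ) f j φ‖ ≤ ‖f‖ := by
    intro f j
    rw [birkhoffAverage, birkhoffSum, norm_smul, norm_inv, RCLike.norm_natCast]
    rcases Nat.eq_zero_or_pos j with rfl | hj
    · simp
    have hj' : (0 : ℝ) < j := by exact_mod_cast hj
    rw [inv_mul_le_iff₀ hj']
    refine (norm_sum_le _ _).trans ((Finset.sum_le_sum fun i _ => f.norm_coe_le_norm _).trans ?_)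
    simp
  have hi : ∀ f : C(UnitAddCircle, ℂ), ‖∫ θ : UnitAddCircle, f θ‖ ≤ ‖f‖ := by
    intro f
    refine (norm_integral_le_of_norm_le_const (ae_of_all _ fun θ => f.norm_coe_le_norm θ)).trans ?_
    rw [probReal_univ, mul_one]
  rw [Metric.tendsto_atTop]
  intro ε hε
  obtain ⟨f, hf, hfh⟩ := Metric.mem_closure_iff.1 hcl (ε / 4) (by linarith)
  obtain ⟨N, hN⟩ := Metric.tendsto_atTop.1 (hspan f hf) (ε / 4) (by linarith)
  refine ⟨N, fun j hj => ?_⟩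
  have h1 := hN j hj
  rw [dist_eq_norm] at hfh h1 ⊢
  have h2 := hb (h - f) j
  have h3 := hi (h - f)
  have e2 : birkhoffAverage ℂ (fun φ : UnitAddCircle => m • φ) (h - f : C(UnitAddCircle, ℂ)) j φ =
      birkhoffAverage ℂ (fun φ : UnitAddCircle => m • φ) h j φ -
      birkhoffAverage ℂ (fun φ : UnitAddCircle => m • φ) f j φ := by
    simp [birkhoffAverage, birkhoffSum, mul_sub]
  have e3 : ∫ θ : UnitAddCircle, (h - f : C(UnitAddCircle, ℂ)) θ =
      (∫ θ : UnitAddCircle, h θ) - ∫ θ : UnitAddCircle, f θ := by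
    simp only [ContinuousMap.coe_sub, Pi.sub_apply]
    exact integral_sub (h.continuous.integrable_of_hasCompactSupport
        (HasCompactSupport.of_compactSpace _))
      (f.continuous.integrable_of_hasCompactSupport (HasCompactSupport.of_compactSpace _))
  rw [e2] at h2
  rw [e3] at h3
  set a := birkhoffAverage ℂ (fun φ : UnitAddCircle => m • φ) h j φ
  set b := birkhoffAverage ℂ (fun φ : UnitAddCircle => m • φ) f j φ
  have : a - ∫ θ : UnitAddCircle, h θ = (a - b) + (b - ∫ θ : UnitAddCircle, f θ) -
      ((∫ θ : UnitAddCircle, h θ) - ∫ θ : UnitAddCircle, f θ) := by ring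
  rw [this]
  refine (norm_sub_le _ _).trans_lt ?_
  have := norm_add_le (a - b) (b - ∫ θ : UnitAddCircle, f θ)
  linarith

end Equidistribution

/-! ### Skew maps contracting the fibers: topology of the attractor -/

section Contracting

theorem maximalAttractor_subset {X : Type*} {F : X → X} {D : Set X} :
    maximalAttractor F D ⊆ D := by
  intro p hp
  simpa using Set.mem_iInter.1 hp 0

variable {M : Type*} [TopologicalSpace M]

/-- A continuous open map `G` of `S¹ × M` over `φ ↦ m φ` which maps `S¹ × B` into `S¹ × int B`,
`B` compact, and whose iterates shrink the fibers `{φ} × B` uniformly. The shrinking is measured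
by continuous functions, so that no metric on `M` has to be chosen. -/
structure IsContractingSkew (m : ℕ) (G : UnitAddCircle × M → UnitAddCircle × M) (B : Set M) :
    Prop where
  continuous : Continuous G
  isOpenMap : IsOpenMap G
  fst_apply : ∀ p, (G p).1 = m • p.1
  isCompact : IsCompact B
  mapsTo : ∀ p, p.2 ∈ B → (G p).2 ∈ interior B
  contract : ∀ f : C(UnitAddCircle × M, ℝ), ∀ ε > 0, ∃ k₀ : ℕ, ∀ k ≥ k₀, ∀ φ, ∀ x ∈ B, ∀ y ∈ B,
    |f (G^[k] (φ, x)) - f (G^[k] (φ, y))| ≤ ε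

namespace IsContractingSkew

variable {m : ℕ} {G : UnitAddCircle × M → UnitAddCircle × M} {B : Set M}

theorem iterate_fst (hG : IsContractingSkew m G B) (k : ℕ) (p : UnitAddCircle × M) :
    (G^[k] p).1 = m ^ k • p.1 := by
  induction k with
  | zero => simp
  | succ k ih => rw [Function.iterate_succ_apply', hG.fst_apply, ih, pow_succ', mul_smul]

theorem iterate_snd_mem (hG : IsContractingSkew m G B) (k : ℕ) {p : UnitAddCircle × M}
    (hp : p.2 ∈ B) : (G^[k] p).2 ∈ B := by
  induction k with
  | zero => simpa
  | succ k ih => rw [Function.iterate_succ_apply']; exact interior_subset (hG.mapsTo _ ih)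

theorem isTrapping (hG : IsContractingSkew m G B) : IsTrapping G (Set.univ ×ˢ B) := by
  refine ⟨isCompact_univ.prod hG.isCompact, ?_⟩
  rw [interior_prod_eq, interior_univ]
  rintro _ ⟨p, hp, rfl⟩
  exact ⟨trivial, hG.mapsTo p hp.2⟩

theorem image_iterate_subset (hG : IsContractingSkew m G B) {i j : ℕ} (hij : i ≤ j) :
    G^[j] '' (Set.univ ×ˢ B) ⊆ G^[i] '' (Set.univ ×ˢ B) := by
  rintro _ ⟨p, hp, rfl⟩
  refine ⟨G^[j - i] p, ⟨trivial, hG.iterate_snd_mem _ hp.2⟩, ?_⟩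
  rw [← Function.iterate_add_apply, Nat.add_sub_cancel' hij]

theorem isClosed_maximalAttractor [T2Space M] (hG : IsContractingSkew m G B) :
    IsClosed (maximalAttractor G (Set.univ ×ˢ B)) :=
  isClosed_iInter fun k =>
    ((isCompact_univ.prod hG.isCompact).image (hG.continuous.iterate k)).isClosed

theorem apply_mem_maximalAttractor (hG : IsContractingSkew m G B) {p : UnitAddCircle × M}
    (hp : p ∈ maximalAttractor G (Set.univ ×ˢ B)) :
    G p ∈ maximalAttractor G (Set.univ ×ˢ B) := by
  refine Set.mem_iInter.2 fun k => hG.image_iterate_subset (Nat.le_succ k) ?_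
  obtain ⟨q, hq, rfl⟩ := Set.mem_iInter.1 hp k
  exact ⟨q, hq, Function.iterate_succ_apply' _ _ _⟩

/-- A set each of whose points is the image of another of its points under some iterate lies in
the attractor. -/
theorem subset_maximalAttractor (hG : IsContractingSkew m G B) {W : Set (UnitAddCircle × M)}
    (hWB : W ⊆ Set.univ ×ˢ B) (hW : ∀ p ∈ W, ∃ k ≥ 1, ∃ q ∈ W, G^[k] q = p) :
    W ⊆ maximalAttractor G (Set.univ ×ˢ B) := by
  have key : ∀ N : ℕ, ∀ p ∈ W, ∃ k ≥ N, ∃ q ∈ W, G^[k] q = p := by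
    intro N
    induction N with
    | zero => intro p hp; exact ⟨0, le_rfl, p, hp, rfl⟩
    | succ N ih =>
      intro p hp
      obtain ⟨k, hk, q, hq, rfl⟩ := ih p hp
      obtain ⟨l, hl, r, hr, rfl⟩ := hW q hq
      exact ⟨k + l, by omega, r, hr, Function.iterate_add_apply _ _ _ _⟩
  intro p hp
  refine Set.mem_iInter.2 fun N => ?_
  obtain ⟨k, hk, q, hq, rfl⟩ := key N p hp
  exact hG.image_iterate_subset hk ⟨q, hWB hq, rfl⟩

/-- Every neighbourhood of a point of the attractor contains the image under an iterate of a
solid cylinder `U × B`. -/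
theorem exists_iterate_mem [CompactSpace M] [T2Space M] (hG : IsContractingSkew m G B)
    {p : UnitAddCircle × M} (hp : p ∈ maximalAttractor G (Set.univ ×ˢ B))
    {V : Set (UnitAddCircle × M)} (hV : IsOpen V) (hpV : p ∈ V) :
    ∃ k : ℕ, ∃ U : Set UnitAddCircle, IsOpen U ∧ U.Nonempty ∧
      ∀ φ ∈ U, ∀ x ∈ B, G^[k] (φ, x) ∈ V := by
  obtain ⟨f, hf0, hf1, -⟩ := exists_continuous_zero_one_of_isClosed (isClosed_singleton (x := p))
    hV.isClosed_compl (Set.disjoint_singleton_left.2 fun h => h hpV)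
  obtain ⟨k, hk⟩ := hG.contract f (1 / 4) (by norm_num)
  obtain ⟨⟨φ, x⟩, ⟨-, hx⟩, hφx⟩ := Set.mem_iInter.1 hp k
  have hlt : ∀ y ∈ B, f (G^[k] (φ, y)) < 1 / 2 := by
    intro y hy
    have h1 := hk k le_rfl φ y hy x hx
    have h2 : f p = 0 := hf0 rfl
    rw [hφx, h2] at h1
    have := (abs_le.1 h1).2
    linarith
  have hopen : IsOpen {q : UnitAddCircle × M | f (G^[k] q) < 1 / 2} :=
    isOpen_lt (f.continuous.comp (hG.continuous.iterate k)) continuous_const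
  obtain ⟨U, V', hU, -, hφU, hBV', hUV⟩ := generalized_tube_lemma (isCompact_singleton (x := φ))
    hG.isCompact hopen (by
      rintro ⟨a, y⟩ ⟨ha, hy⟩
      obtain rfl : a = φ := ha
      exact hlt y hy)
  refine ⟨k, U, hU, ⟨φ, hφU rfl⟩, fun a ha y hy => ?_⟩
  by_contra hcon
  have h1 : f (G^[k] (a, y)) = 1 := hf1 hcon
  have h2 : f (G^[k] (a, y)) < 1 / 2 := hUV (show (a, y) ∈ U ×ˢ V' from ⟨ha, hBV' hy⟩)
  linarith

/-- If a cylinder `S¹ × W₀` is covered by its images and meets one of them under `G` itself, then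
the attractor is the closure of the union of all images of this cylinder. -/
theorem isRegion_maximalAttractor [CompactSpace M] [T2Space M] (hG : IsContractingSkew m G B)
    {W₀ : Set M} (hWo : IsOpen W₀) (hWc : IsConnected W₀) (hWB : W₀ ⊆ B)
    (hcov : ∀ p : UnitAddCircle × M, p.2 ∈ W₀ → ∃ k ≥ 1, ∃ q : UnitAddCircle × M,
      q.2 ∈ W₀ ∧ G^[k] q = p)
    (hmeet : ∃ p : UnitAddCircle × M, p.2 ∈ W₀ ∧ (G p).2 ∈ W₀) :
    IsRegion (maximalAttractor G (Set.univ ×ˢ B)) := by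
  set W : Set (UnitAddCircle × M) := Set.univ ×ˢ W₀ with hW
  have hWconn : IsConnected W := isConnected_univ.prod hWc
  have hWA : W ⊆ maximalAttractor G (Set.univ ×ˢ B) :=
    hG.subset_maximalAttractor (Set.prod_mono le_rfl hWB) fun p hp => by
      obtain ⟨k, hk, q, hq, h⟩ := hcov p hp.2
      exact ⟨k, hk, q, ⟨trivial, hq⟩, h⟩
  have hopen : ∀ k : ℕ, IsOpen (G^[k] '' W) := by
    intro k
    induction k with
    | zero => simpa using isOpen_univ.prod hWo
    | succ k ih =>
      rw [Function.iterate_succ', Set.image_comp]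
      exact hG.isOpenMap _ ih
  refine ⟨⋃ k : ℕ, G^[k] '' W, isOpen_iUnion hopen, ?_, ?_⟩
  · refine IsConnected.iUnion_of_chain
      (fun k => hWconn.image _ (hG.continuous.iterate k).continuousOn) fun k => ?_
    obtain ⟨p, hp, hGp⟩ := hmeet
    refine ⟨G^[k + 1] p, ⟨G p, ⟨trivial, hGp⟩, ?_⟩, ⟨p, ⟨trivial, hp⟩, rfl⟩⟩
    exact (Function.iterate_succ_apply _ _ _).symm
  · refine Set.Subset.antisymm (fun p hp => ?_)
      (closure_minimal (Set.iUnion_subset fun k => ?_) hG.isClosed_maximalAttractor)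
    · refine mem_closure_iff.2 fun V hV hpV => ?_
      obtain ⟨k, U, -, ⟨φ, hφ⟩, hUV⟩ := hG.exists_iterate_mem hp hV hpV
      obtain ⟨x, hx⟩ := hWc.nonempty
      exact ⟨_, hUV φ hφ x (hWB hx), Set.mem_iUnion.2 ⟨k, (φ, x), ⟨trivial, hx⟩, rfl⟩⟩
    · rintro _ ⟨p, hp, rfl⟩
      induction k with
      | zero => exact hWA hp
      | succ k ih => rw [Function.iterate_succ_apply']; exact hG.apply_mem_maximalAttractor ih

end IsContractingSkew

end Contracting

/-! ### The invariant measure of a skew map contracting the fibers -/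

section Measure

variable {M : Type*} [TopologicalSpace M]
  {m : ℕ} {G : UnitAddCircle × M → UnitAddCircle × M} {B : Set M}

theorem measurePreserving_pow_nsmul {m : ℕ} (hm : 2 ≤ m) (k : ℕ) :
    MeasurePreserving (fun φ : UnitAddCircle => m ^ k • φ) := by
  have := (AddCircle.ergodic_nsmul (T := 1) (n := m) hm).toMeasurePreserving.iterate k
  rwa [smul_iterate] at this

namespace IsContractingSkew

theorem continuous_iterate_section (hG : IsContractingSkew m G B) (k : ℕ) (x : M) :
    Continuous fun φ : UnitAddCircle => G^[k] (φ, x) :=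
  (hG.continuous.iterate k).comp (by fun_prop)

theorem integrable_iterate_section [CompactSpace M] (hG : IsContractingSkew m G B)
    (f : C(UnitAddCircle × M, ℝ)) (k : ℕ) (x : M) :
    Integrable fun φ : UnitAddCircle => f (G^[k] (φ, x)) :=
  (f.continuous.comp (hG.continuous_iterate_section k x)).integrable_of_hasCompactSupport
    (HasCompactSupport.of_compactSpace _)

/-- For large `k`, the value of `f ∘ Gᵏ` at `Gʲ (φ, x)` is almost determined by the base point
`mʲ φ`, uniformly in `j`. -/
theorem abs_iterate_add_sub_le (hG : IsContractingSkew m G B) (f : C(UnitAddCircle × M, ℝ))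
    {ε : ℝ} (hε : 0 < ε) {x₀ : M} (hx₀ : x₀ ∈ B) :
    ∃ k₀ : ℕ, ∀ k ≥ k₀, ∀ j : ℕ, ∀ φ, ∀ x ∈ B,
      |f (G^[k + j] (φ, x)) - f (G^[k] (m ^ j • φ, x₀))| ≤ ε := by
  obtain ⟨k₀, hk₀⟩ := hG.contract f ε hε
  refine ⟨k₀, fun k hk j φ x hx => ?_⟩
  rw [Function.iterate_add_apply]
  have h1 : G^[j] (φ, x) = (m ^ j • φ, (G^[j] (φ, x)).2) :=
    Prod.ext (hG.iterate_fst j _) rfl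
  rw [h1]
  exact hk₀ k hk _ _ (hG.iterate_snd_mem j hx) _ hx₀

/-- The integrals of a continuous function against the images of Lebesgue measure on a horizontal
circle `S¹ × {x₀}` converge. -/
theorem exists_tendsto_integral [CompactSpace M] (hG : IsContractingSkew m G B) (hm : 2 ≤ m)
    {x₀ : M} (hx₀ : x₀ ∈ B) (f : C(UnitAddCircle × M, ℝ)) :
    ∃ L : ℝ, Tendsto (fun k : ℕ => ∫ φ : UnitAddCircle, f (G^[k] (φ, x₀))) atTop (𝓝 L) := by
  refine cauchySeq_tendsto_of_complete (Metric.cauchySeq_iff'.2 fun ε hε => ?_)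
  -- replacing `G^[k + j] (φ, x₀)` by `G^[k] (m ^ j • φ, x₀)` changes the integrand little, and
  -- after this replacement the integral no longer depends on `j`, by invariance of Lebesgue measure
  obtain ⟨k, hk⟩ := hG.abs_iterate_add_sub_le f (half_pos hε) hx₀
  refine ⟨k, fun n hn => ?_⟩
  obtain ⟨j, rfl⟩ := Nat.exists_eq_add_of_le hn
  have hinv : ∫ φ : UnitAddCircle, f (G^[k] (φ, x₀)) =
      ∫ φ : UnitAddCircle, f (G^[k] (m ^ j • φ, x₀)) := by
    have hmp := measurePreserving_pow_nsmul hm j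
    rw [← hmp.map_eq, integral_map hmp.measurable.aemeasurable, hmp.map_eq]
    rw [hmp.map_eq]
    exact (hG.integrable_iterate_section f k x₀).aestronglyMeasurable
  have hint : Integrable fun φ : UnitAddCircle => f (G^[k] (m ^ j • φ, x₀)) :=
    (f.continuous.comp ((hG.continuous_iterate_section k x₀).comp
      (continuous_const_smul _))).integrable_of_hasCompactSupport
      (HasCompactSupport.of_compactSpace _)
  rw [Real.dist_eq, hinv, ← integral_sub (hG.integrable_iterate_section f _ x₀) hint]
  refine lt_of_le_of_lt ?_ (half_lt_self hε)
  have := norm_integral_le_of_norm_le_const (μ := (volume : Measure UnitAddCircle))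
    (ae_of_all _ fun φ => (Real.norm_eq_abs _).trans_le (hk k le_rfl j φ x₀ hx₀))
  simpa [probReal_univ] using this

end IsContractingSkew

variable [MeasurableSpace M]

/-- The measure `μ` is the limit of the images under the iterates of `G` of Lebesgue measure on
the horizontal circle `S¹ × {x₀}`. -/
structure IsLimitLaw (G : UnitAddCircle × M → UnitAddCircle × M) (x₀ : M)
    (μ : Measure (UnitAddCircle × M)) : Prop where
  isProbabilityMeasure : IsProbabilityMeasure μ
  tendsto : ∀ f : C(UnitAddCircle × M, ℝ),
    Tendsto (fun k : ℕ => ∫ φ : UnitAddCircle, f (G^[k] (φ, x₀))) atTop (𝓝 (∫ p, f p ∂μ))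

namespace IsContractingSkew

theorem exists_isLimitLaw [CompactSpace M] [T2Space M] [BorelSpace M]
    (hG : IsContractingSkew m G B) (hm : 2 ≤ m) {x₀ : M} (hx₀ : x₀ ∈ B) :
    ∃ μ : Measure (UnitAddCircle × M), IsLimitLaw G x₀ μ := by
  have hmeas : ∀ k, Measurable fun φ : UnitAddCircle => G^[k] (φ, x₀) :=
    fun k => (hG.continuous_iterate_section k x₀).measurable
  let ν : ℕ → ProbabilityMeasure (UnitAddCircle × M) := fun k =>
    ⟨(volume : Measure UnitAddCircle).map fun φ => G^[k] (φ, x₀),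
      Measure.isProbabilityMeasure_map (hmeas k).aemeasurable⟩
  -- a limit along an ultrafilter exists by compactness; the integrals converge along `atTop`, so it
  -- is the limit of the whole sequence
  obtain ⟨μ, -, hμ⟩ :=
    (isCompact_univ (X := ProbabilityMeasure (UnitAddCircle × M))).ultrafilter_le_nhds
      ((hyperfilter ℕ).map ν) (by simp)
  refine ⟨μ, inferInstance, fun f => ?_⟩
  obtain ⟨L, hL⟩ := hG.exists_tendsto_integral hm hx₀ f
  have h1 := (ProbabilityMeasure.tendsto_iff_forall_integral_tendsto
    (F := (hyperfilter ℕ : Filter ℕ)) (μs := ν) (μ := μ)).1 hμ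
    (BoundedContinuousFunction.mkOfCompact f)
  have h2 : ∀ k, ∫ p, f p ∂(ν k : Measure (UnitAddCircle × M)) =
      ∫ φ : UnitAddCircle, f (G^[k] (φ, x₀)) := fun k =>
    integral_map (hmeas k).aemeasurable f.continuous.measurable.aestronglyMeasurable
  have h3 : Tendsto (fun k : ℕ => ∫ φ : UnitAddCircle, f (G^[k] (φ, x₀))) (hyperfilter ℕ)
      (𝓝 (∫ p, f p ∂(μ : Measure (UnitAddCircle × M)))) := by
    refine Tendsto.congr h2 ?_
    simpa using h1
  have h4 := hL.mono_left (Nat.hyperfilter_le_atTop)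
  rwa [tendsto_nhds_unique h3 h4]

end IsContractingSkew

end Measure

/-! ### Support, basin and ergodicity of the invariant measure -/

section LimitLaw

variable {M : Type*} [TopologicalSpace M] [MeasurableSpace M]
  {m : ℕ} {G : UnitAddCircle × M → UnitAddCircle × M} {B : Set M} {x₀ : M}
  {μ : Measure (UnitAddCircle × M)}

theorem integrable_continuousMap {X : Type*} [TopologicalSpace X] [CompactSpace X]
    [MeasurableSpace X] [OpensMeasurableSpace X] {μ : Measure X} [IsFiniteMeasure μ]
    (f : C(X, ℝ)) : Integrable f μ :=
  f.continuous.integrable_of_hasCompactSupport (HasCompactSupport.of_compactSpace _)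

namespace IsLimitLaw

theorem measurePreserving [CompactSpace M] [T2Space M] [SecondCountableTopology M] [BorelSpace M]
    (hμ : IsLimitLaw G x₀ μ) (hG : Continuous G) :
    MeasurePreserving G μ μ := by
  have := hμ.isProbabilityMeasure
  refine ⟨hG.measurable, ?_⟩
  have := Measure.isProbabilityMeasure_map (μ := μ) hG.measurable.aemeasurable
  refine ext_of_forall_integral_eq_of_IsFiniteMeasure fun f => ?_
  rw [integral_map hG.measurable.aemeasurable f.continuous.measurable.aestronglyMeasurable]
  have h1 := hμ.tendsto (f.toContinuousMap.comp ⟨G, hG⟩)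
  have h2 := (hμ.tendsto f.toContinuousMap).comp (tendsto_add_atTop_nat 1)
  refine tendsto_nhds_unique h1 (h2.congr fun k => integral_congr_ae (ae_of_all _ fun φ => ?_))
  simp [Function.iterate_succ_apply']

theorem measurePreserving_fst [T2Space M] [SecondCountableTopology M] [BorelSpace M]
    (hμ : IsLimitLaw G x₀ μ) (hG : IsContractingSkew m G B)
    (hm : 2 ≤ m) : MeasurePreserving Prod.fst μ volume := by
  have := hμ.isProbabilityMeasure
  refine ⟨measurable_fst, ?_⟩
  have := Measure.isProbabilityMeasure_map (μ := μ) measurable_fst.aemeasurable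
  refine ext_of_forall_integral_eq_of_IsFiniteMeasure fun f => ?_
  rw [integral_map measurable_fst.aemeasurable f.continuous.measurable.aestronglyMeasurable]
  have h1 := hμ.tendsto (f.toContinuousMap.comp ⟨Prod.fst, continuous_fst⟩)
  refine tendsto_nhds_unique h1 (tendsto_const_nhds.congr fun k => ?_)
  have hmp := measurePreserving_pow_nsmul hm k
  have h2 := integral_map (f := f) (μ := volume) hmp.measurable.aemeasurable
    f.continuous.measurable.aestronglyMeasurable
  rw [hmp.map_eq] at h2
  rw [h2]
  refine integral_congr_ae (ae_of_all _ fun φ => ?_)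
  simp [hG.iterate_fst]

/-- The support is contained in each `Gᵏ(S¹ × B)`, since this set carries all later laws.
Conversely, a neighbourhood of a point of the attractor contains the image under some `Gᵏ` of a
solid cylinder `U × B`, so that all later laws give it at least the Lebesgue measure of `U`. -/
theorem support_eq [CompactSpace M] [T2Space M] [SecondCountableTopology M] [BorelSpace M]
    (hμ : IsLimitLaw G x₀ μ) (hG : IsContractingSkew m G B)
    (hm : 2 ≤ m) (hx₀ : x₀ ∈ B) :
    μ.support = maximalAttractor G (Set.univ ×ˢ B) := by
  have := hμ.isProbabilityMeasure
  refine Set.Subset.antisymm (fun p hp => ?_) fun p hp => ?_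
  · refine Set.mem_iInter.2 fun k => ?_
    by_contra hcon
    have hK : IsClosed (G^[k] '' (Set.univ ×ˢ B)) :=
      ((isCompact_univ.prod hG.isCompact).image (hG.continuous.iterate k)).isClosed
    have hV : IsOpen (G^[k] '' (Set.univ ×ˢ B))ᶜ := hK.isOpen_compl
    obtain ⟨f, hf0, hf1, hf01⟩ := exists_continuous_zero_one_of_isClosed hK
      (isClosed_singleton (x := p)) (Set.disjoint_singleton_right.2 hcon)
    have hint : ∫ q, f q ∂μ = 0 := by
      refine tendsto_nhds_unique (hμ.tendsto f) (tendsto_const_nhds.congr' ?_)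
      filter_upwards [eventually_ge_atTop k] with j hj
      have h0 : ∀ φ : UnitAddCircle, f (G^[j] (φ, x₀)) = 0 := fun φ =>
        hf0 (hG.image_iterate_subset hj ⟨(φ, x₀), ⟨trivial, hx₀⟩, rfl⟩)
      simp [h0]
    have hae := (integral_eq_zero_iff_of_nonneg (fun q => (hf01 q).1)
      (integrable_continuousMap f)).1 hint
    have hnull : μ {q | f q ≠ 0} = 0 := hae
    have hopen : IsOpen {q | f q ≠ 0} := isOpen_ne_fun f.continuous continuous_const
    have hpos := (Measure.mem_support_iff_forall p).1 hp _ (hopen.mem_nhds (by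
      have : f p = 1 := hf1 rfl
      simp [this]))
    exact hpos.ne' hnull
  · refine (Measure.mem_support_iff_forall p).2 fun V hV => ?_
    obtain ⟨V', hV'V, hV'o, hpV'⟩ := mem_nhds_iff.1 hV
    obtain ⟨f, hf1, hf0, -, hf01⟩ := exists_continuous_one_zero_of_isCompact
      (isCompact_singleton (x := p)) hV'o.isClosed_compl
      (Set.disjoint_singleton_left.2 fun h => h hpV')
    have hVo : IsOpen {q | (1 / 2 : ℝ) < f q} := isOpen_lt continuous_const f.continuous
    obtain ⟨k, U, hU, hUne, hUV⟩ := hG.exists_iterate_mem hp hVo (by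
      have : f p = 1 := hf1 rfl
      simp only [Set.mem_ofPred_eq, this]; norm_num)
    have hUpos : 0 < (volume : Measure UnitAddCircle).real U :=
      ENNReal.toReal_pos (hU.measure_pos _ hUne).ne' (measure_ne_top _ _)
    have hlow : ∀ j, 1 / 2 * (volume : Measure UnitAddCircle).real U ≤
        ∫ φ : UnitAddCircle, f (G^[k + j] (φ, x₀)) := by
      intro j
      have hmp := measurePreserving_pow_nsmul hm j
      have hmU : MeasurableSet ((fun φ : UnitAddCircle => m ^ j • φ) ⁻¹' U) :=
        hmp.measurable hU.measurableSet
      have heq : (volume : Measure UnitAddCircle).real U =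
          (volume : Measure UnitAddCircle).real ((fun φ : UnitAddCircle => m ^ j • φ) ⁻¹' U) := by
        rw [measureReal_def, measureReal_def,
          hmp.measure_preimage hU.measurableSet.nullMeasurableSet]
      rw [heq, mul_comm, ← smul_eq_mul, ← integral_indicator_const _ hmU]
      refine integral_mono ((integrable_const _).indicator hmU)
        (hG.integrable_iterate_section f _ x₀) fun φ => ?_
      by_cases hφ : φ ∈ (fun φ : UnitAddCircle => m ^ j • φ) ⁻¹' U
      · rw [Set.indicator_of_mem hφ]
        have h1 : G^[j] (φ, x₀) = (m ^ j • φ, (G^[j] (φ, x₀)).2) :=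
          Prod.ext (hG.iterate_fst j _) rfl
        have h2 := hUV _ hφ _ (hG.iterate_snd_mem j (p := (φ, x₀)) hx₀)
        rw [← h1, ← Function.iterate_add_apply] at h2
        exact (show 1 / 2 < f _ from h2).le
      · rw [Set.indicator_of_notMem hφ]
        exact (hf01 _).1
    have hpos : 0 < ∫ q, f q ∂μ := by
      refine lt_of_lt_of_le (by positivity : 0 < 1 / 2 * (volume : Measure UnitAddCircle).real U)
        (ge_of_tendsto (hμ.tendsto f) ?_)
      filter_upwards [eventually_ge_atTop k] with j hj
      obtain ⟨i, rfl⟩ := Nat.exists_eq_add_of_le hj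
      exact hlow i
    by_contra hcon
    have hV0 : μ V' = 0 := le_antisymm ((measure_mono hV'V).trans (not_lt.1 hcon)) bot_le
    have hae : f =ᵐ[μ] 0 := by
      have : ∀ᵐ q ∂μ, q ∉ V' := measure_eq_zero_iff_ae_notMem.1 hV0
      filter_upwards [this] with q hq using hf0 hq
    rw [integral_congr_ae hae] at hpos
    simp at hpos

theorem ae_snd_mem [CompactSpace M] [T2Space M] [SecondCountableTopology M] [BorelSpace M]
    (hμ : IsLimitLaw G x₀ μ) (hG : IsContractingSkew m G B)
    (hm : 2 ≤ m) (hx₀ : x₀ ∈ B) : ∀ᵐ p ∂μ, p.2 ∈ B := by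
  have h : μ.support ∈ ae μ := Measure.support_mem_ae
  rw [hμ.support_eq hG hm hx₀] at h
  filter_upwards [h] with p hp using (maximalAttractor_subset hp).2

/-- For almost every `φ`, the whole fiber `{φ} × B` lies in the basin: along this fiber the values
of `f ∘ Gᵏ`, `k` large, are almost determined by the base point, whose orbit is equidistributed. -/
theorem ae_mem_statBasin [CompactSpace M] (hμ : IsLimitLaw G x₀ μ) (hG : IsContractingSkew m G B)
    (hm : 2 ≤ m) (hx₀ : x₀ ∈ B) :
    ∀ᵐ φ : UnitAddCircle, ∀ x ∈ B, (φ, x) ∈ statBasin G μ := by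
  filter_upwards [ae_tendsto_birkhoffAverage_nsmul hm] with φ hφ x hx f
  have hbdd : Bornology.IsBounded (Set.range f) := by
    rw [isBounded_iff_forall_norm_le]
    exact ⟨‖f‖, by rintro _ ⟨q, rfl⟩; exact f.norm_coe_le_norm q⟩
  -- time averages may be started at a later time
  have hshift : ∀ k, Tendsto (fun j => birkhoffAverage ℝ G f j (G^[k] (φ, x)) -
      birkhoffAverage ℝ G f j (φ, x)) atTop (𝓝 0) := by
    intro k
    induction k with
    | zero => simp
    | succ k ih =>
      have := (tendsto_birkhoffAverage_apply_sub_birkhoffAverage' ℝ hbdd G (G^[k] (φ, x))).add ih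
      simp only [add_zero] at this
      refine this.congr fun j => ?_
      rw [Function.iterate_succ_apply']; ring
  rw [Metric.tendsto_atTop]
  intro ε hε
  -- four errors of size `ε / 8`: starting at time `k`, passing to the base orbit, equidistribution
  -- of the base orbit, and the distance of the law at time `k` from its limit
  obtain ⟨k₁, hk₁⟩ := hG.abs_iterate_add_sub_le f (by linarith : 0 < ε / 8) hx₀
  obtain ⟨k₂, hk₂⟩ := Metric.tendsto_atTop.1 (hμ.tendsto f) (ε / 8) (by linarith)
  set k := max k₁ k₂ with hk
  obtain ⟨N₁, hN₁⟩ := Metric.tendsto_atTop.1 (hshift k) (ε / 8) (by linarith)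
  let h : C(UnitAddCircle, ℂ) :=
    ⟨fun θ => (f (G^[k] (θ, x₀)) : ℂ), Complex.continuous_ofReal.comp
      (f.continuous.comp (hG.continuous_iterate_section k x₀))⟩
  obtain ⟨N₂, hN₂⟩ := Metric.tendsto_atTop.1 (hφ h) (ε / 8) (by linarith)
  refine ⟨max (max N₁ N₂) 1, fun N hN => ?_⟩
  have hN0 : (0 : ℝ) < N := by
    have : 1 ≤ N := (le_max_right _ _).trans hN
    exact_mod_cast this
  have e1 := hN₁ N ((le_max_left _ _).trans ((le_max_left _ _).trans hN))
  have e2 := hN₂ N ((le_max_right _ _).trans ((le_max_left _ _).trans hN))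
  have e3 := hk₂ k (le_max_right _ _)
  have hcast1 : birkhoffAverage ℂ (fun φ : UnitAddCircle => m • φ) h N φ =
      (((N : ℝ)⁻¹ * ∑ i ∈ Finset.range N, f (G^[k] (m ^ i • φ, x₀)) : ℝ) : ℂ) := by
    simp [birkhoffAverage, birkhoffSum, h, iterate_nsmul_apply]
  have hcast2 : ∫ θ : UnitAddCircle, h θ =
      ((∫ θ : UnitAddCircle, f (G^[k] (θ, x₀)) : ℝ) : ℂ) := integral_ofReal
  rw [hcast1, hcast2, dist_eq_norm, ← Complex.ofReal_sub, Complex.norm_real, Real.norm_eq_abs] at e2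
  rw [Real.dist_eq, sub_zero] at e1
  rw [Real.dist_eq] at e3 ⊢
  have e4 : |birkhoffAverage ℝ G f N (G^[k] (φ, x)) -
      (N : ℝ)⁻¹ * ∑ i ∈ Finset.range N, f (G^[k] (m ^ i • φ, x₀))| ≤ ε / 8 := by
    rw [birkhoffAverage, birkhoffSum, smul_eq_mul, ← mul_sub, ← Finset.sum_sub_distrib, abs_mul,
      abs_of_pos (inv_pos.2 hN0), inv_mul_le_iff₀ hN0]
    refine (Finset.abs_sum_le_sum_abs _ _).trans ?_
    refine (Finset.sum_le_sum (g := fun _ => ε / 8) fun i _ => ?_).trans (by simp)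
    rw [← Function.iterate_add_apply, add_comm]
    exact hk₁ k (le_max_left _ _) i φ x hx
  rw [abs_lt] at e1 e2 e3 ⊢
  rw [abs_le] at e4
  constructor <;> linarith [e1.1, e1.2, e2.1, e2.2, e3.1, e3.2, e4.1, e4.2]

/-- The law `μ` projects to Lebesgue measure on the circle and is carried by `S¹ × B`. -/
theorem ae_mem_statBasin' [CompactSpace M] [T2Space M] [SecondCountableTopology M] [BorelSpace M]
    (hμ : IsLimitLaw G x₀ μ) (hG : IsContractingSkew m G B)
    (hm : 2 ≤ m) (hx₀ : x₀ ∈ B) : ∀ᵐ p ∂μ, p ∈ statBasin G μ := by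
  filter_upwards [hμ.ae_snd_mem hG hm hx₀,
    (hμ.measurePreserving_fst hG hm).quasiMeasurePreserving.ae
    (hμ.ae_mem_statBasin hG hm hx₀)] with p hp h using h _ hp

end IsLimitLaw

/-- An invariant measure is ergodic if almost every point lies in its basin: the restriction of
`μ` to an invariant set `s` then has the same integrals of continuous functions as `μ s • μ`. -/
theorem ergodic_of_ae_mem_statBasin {X : Type*} [TopologicalSpace X] [CompactSpace X]
    [MeasurableSpace X] [BorelSpace X] [HasOuterApproxClosed X] {F : X → X} {μ : Measure X}
    [IsProbabilityMeasure μ] (hF : MeasurePreserving F μ μ) (h : ∀ᵐ p ∂μ, p ∈ statBasin F μ) :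
    Ergodic F μ := by
  refine ⟨hF, ⟨fun s hs hFs => ?_⟩⟩
  have hinv : ∀ i : ℕ, F^[i] ⁻¹' s = s := by
    intro i
    induction i with
    | zero => rfl
    | succ i ih => rw [Function.iterate_succ, Set.preimage_comp, ih, hFs]
  have hres : ∀ i, MeasurePreserving F^[i] (μ.restrict s) (μ.restrict s) := by
    intro i
    have := (hF.iterate i).restrict_preimage hs
    rwa [hinv i] at this
  -- integrate the time averages over `s` and pass to the limit
  have key : ∀ f : C(X, ℝ), ∫ p in s, f p ∂μ = μ.real s * ∫ p, f p ∂μ := by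
    intro f
    have hiter : ∀ i, ∫ p in s, f (F^[i] p) ∂μ = ∫ p in s, f p ∂μ := by
      intro i
      have h2 := integral_map (f := f) (μ := μ.restrict s) (hres i).measurable.aemeasurable
        f.continuous.measurable.aestronglyMeasurable
      rw [(hres i).map_eq] at h2
      exact h2.symm
    have hmeas : ∀ i, Measurable fun p => f (F^[i] p) := fun i =>
      f.continuous.measurable.comp (hF.measurable.iterate i)
    have hint : ∀ i, Integrable (fun p => f (F^[i] p)) (μ.restrict s) := fun i =>
      Integrable.of_bound (hmeas i).aestronglyMeasurable ‖f‖
        (ae_of_all _ fun p => f.norm_coe_le_norm _)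
    have havg : ∀ k : ℕ, 1 ≤ k → ∫ p in s, birkhoffAverage ℝ F f k p ∂μ = ∫ p in s, f p ∂μ := by
      intro k hk
      simp only [birkhoffAverage, birkhoffSum]
      rw [integral_smul, integral_finsetSum _ fun i _ => hint i]
      simp only [hiter, Finset.sum_const, Finset.card_range]
      rw [← Nat.cast_smul_eq_nsmul ℝ, smul_smul, inv_mul_cancel₀, one_smul]
      exact_mod_cast (by omega : k ≠ 0)
    have hbound : ∀ k p, ‖birkhoffAverage ℝ F f k p‖ ≤ ‖f‖ := by
      intro k p
      rw [birkhoffAverage, birkhoffSum, norm_smul, norm_inv, RCLike.norm_natCast]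
      rcases Nat.eq_zero_or_pos k with rfl | hk
      · simp
      have hk' : (0 : ℝ) < k := by exact_mod_cast hk
      rw [inv_mul_le_iff₀ hk']
      refine (norm_sum_le _ _).trans ((Finset.sum_le_sum fun i _ => f.norm_coe_le_norm _).trans ?_)
      simp
    have hlim : Tendsto (fun k => ∫ p in s, birkhoffAverage ℝ F f k p ∂μ) atTop
        (𝓝 (∫ _ in s, (∫ q, f q ∂μ) ∂μ)) := by
      refine tendsto_integral_of_dominated_convergence (fun _ => ‖f‖) (fun k => ?_)
        (integrable_const _) (fun k => ae_of_all _ (hbound k)) ?_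
      · have hm := (Finset.measurable_sum (Finset.range k) fun i _ => hmeas i).const_smul (k : ℝ)⁻¹
        exact hm.aestronglyMeasurable
      · filter_upwards [ae_restrict_of_ae h] with p hp using hp f
    have hlim' : Tendsto (fun k => ∫ p in s, birkhoffAverage ℝ F f k p ∂μ) atTop
        (𝓝 (∫ p in s, f p ∂μ)) :=
      tendsto_const_nhds.congr' ((eventually_ge_atTop 1).mono fun k hk => (havg k hk).symm)
    rw [tendsto_nhds_unique hlim' hlim]
    simp
  have hmeasure : μ.restrict s = μ s • μ := by
    have : IsFiniteMeasure (μ s • μ) := Measure.smul_finite μ (measure_ne_top μ s)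
    refine ext_of_forall_integral_eq_of_IsFiniteMeasure fun f => ?_
    rw [integral_smul_measure]
    exact key f.toContinuousMap
  have h0 : μ s * μ sᶜ = 0 := by
    have := congrArg (fun ν => ν sᶜ) hmeasure
    simpa [Measure.restrict_apply hs.compl] using this.symm
  rw [eventuallyConst_set']
  rcases mul_eq_zero.1 h0 with h0 | h0
  · exact Or.inl (ae_eq_empty.2 h0)
  · exact Or.inr (ae_eq_univ.2 h0)

end LimitLaw

/-! ### A criterion for massive attractors -/

section Massive

theorem IsRegion.univ_prod {M : Type*} [TopologicalSpace M] {B : Set M} (hB : IsRegion B) :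
    IsRegion ((Set.univ : Set UnitAddCircle) ×ˢ B) := by
  obtain ⟨U, hUo, hUc, rfl⟩ := hB
  exact ⟨Set.univ ×ˢ U, isOpen_univ.prod hUo, isConnected_univ.prod hUc, by
    rw [closure_prod_eq, closure_univ]⟩

variable {n : ℕ} {M : Type*} [TopologicalSpace M]
  [ChartedSpace (EuclideanSpace ℝ (Fin n)) M]

theorem lebesgueNull_of_subset_fst_preimage {E : Set (UnitAddCircle × M)} {N : Set UnitAddCircle}
    (hN : volume N = 0) (hE : E ⊆ Prod.fst ⁻¹' N) : LebesgueNull n E := by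
  intro p
  refine measure_mono_null (t := N ×ˢ Set.univ) (fun z hz => ⟨hE hz.2, trivial⟩) ?_
  rw [Measure.volume_eq_prod, Measure.prod_prod, hN, zero_mul]

theorem not_lebesgueNull_prod {N : Set UnitAddCircle} (hN : volume N ≠ 0) {U : Set M}
    (hU : IsOpen U) (hUne : U.Nonempty) : ¬ LebesgueNull n (N ×ˢ U) := by
  intro h
  obtain ⟨p, hp⟩ := hUne
  have h1 := h p
  set κ := chartAt (EuclideanSpace ℝ (Fin n)) p
  have hset : {z : UnitAddCircle × EuclideanSpace ℝ (Fin n) | z.2 ∈ κ.target ∧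
      (z.1, κ.symm z.2) ∈ N ×ˢ U} = N ×ˢ (κ.target ∩ κ.symm ⁻¹' U) := by
    ext z
    constructor
    · rintro ⟨h1, h2, h3⟩; exact ⟨h2, h1, h3⟩
    · rintro ⟨h1, h2, h3⟩; exact ⟨h2, h1, h3⟩
  rw [hset, Measure.volume_eq_prod, Measure.prod_prod] at h1
  have hopen : IsOpen (κ.target ∩ κ.symm ⁻¹' U) := κ.isOpen_inter_preimage_symm hU
  have hne : (κ.target ∩ κ.symm ⁻¹' U).Nonempty := by
    have hps : p ∈ κ.source := mem_chart_source _ p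
    exact ⟨κ p, κ.map_source hps, by simpa [κ.left_inv hps] using hp⟩
  exact (mul_ne_zero hN (hopen.measure_pos _ hne).ne') h1

/-- A skew map contracting the fibers over `B` has a massive attractor as soon as some cylinder
`S¹ × W₀` is covered by its images under the iterates. -/
theorem IsContractingSkew.hasMassiveAttractor [CompactSpace M] [T2Space M]
    [SecondCountableTopology M] [MeasurableSpace M] [BorelSpace M] {m : ℕ} (hm : 2 ≤ m)
    {G : UnitAddCircle × M → UnitAddCircle × M} {B : Set M} (hG : IsContractingSkew m G B)
    (hB : IsRegion B) (hBne : B ≠ Set.univ)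
    {W₀ : Set M} (hWo : IsOpen W₀) (hWc : IsConnected W₀) (hWB : W₀ ⊆ B)
    (hcov : ∀ p : UnitAddCircle × M, p.2 ∈ W₀ → ∃ k ≥ 1, ∃ q : UnitAddCircle × M,
      q.2 ∈ W₀ ∧ G^[k] q = p)
    (hmeet : ∃ p : UnitAddCircle × M, p.2 ∈ W₀ ∧ (G p).2 ∈ W₀) :
    HasMassiveAttractor n G := by
  obtain ⟨x₀, hx₀'⟩ := hWc.nonempty
  have hx₀ : x₀ ∈ B := hWB hx₀'
  obtain ⟨μ, hμ⟩ := hG.exists_isLimitLaw hm hx₀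
  have := hμ.isProbabilityMeasure
  have hbasin := hμ.ae_mem_statBasin hG hm hx₀
  set N := {φ : UnitAddCircle | ¬ ∀ x ∈ B, (φ, x) ∈ statBasin G μ} with hNdef
  have hN : volume N = 0 := hbasin
  refine ⟨Set.univ ×ˢ B, hB.univ_prod, hG.isTrapping, ?_,
    hG.isRegion_maximalAttractor hWo hWc hWB hcov hmeet, μ,
    ⟨this, hμ.measurePreserving hG.continuous, ?_⟩,
    ergodic_of_ae_mem_statBasin (hμ.measurePreserving hG.continuous)
      (hμ.ae_mem_statBasin' hG hm hx₀), hμ.support_eq hG hm hx₀, ?_⟩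
  · intro h
    obtain ⟨x, hx⟩ := (Set.ne_univ_iff_exists_notMem B).1 hBne
    have h1 : ((0, x) : UnitAddCircle × M) ∈ maximalAttractor G (Set.univ ×ˢ B) := h ▸ trivial
    exact hx (maximalAttractor_subset h1).2
  · set N' := toMeasurable volume N
    have hN' : volume N' = 0 := by rw [measure_toMeasurable, hN]
    refine ⟨N'ᶜ ×ˢ W₀, (measurableSet_toMeasurable _ _).compl.prod hWo.measurableSet,
      not_lebesgueNull_prod ?_ hWo hWc.nonempty, ?_⟩
    · rw [prob_compl_eq_one_iff (measurableSet_toMeasurable _ _) |>.2 hN']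
      exact one_ne_zero
    · rintro ⟨φ, x⟩ ⟨hφ, hx⟩
      by_contra hcon
      exact hφ (subset_toMeasurable _ _ fun h => hcon (h x (hWB hx)))
  · refine lebesgueNull_of_subset_fst_preimage hN ?_
    rintro ⟨φ, x⟩ ⟨hx, hnot⟩ h
    exact hnot (h x hx.2)

end Massive

/-! ### Steering along backward orbits of the circle map -/

section Steering

open scoped RealInnerProductSpace

theorem isOpenMap_pow_nsmul {m : ℕ} (hm : 2 ≤ m) (k : ℕ) :
    IsOpenMap fun φ : UnitAddCircle => m ^ k • φ := by
  have : NeZero (m ^ k) := ⟨pow_ne_zero _ (by omega)⟩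
  exact (AddCircle.isAddQuotientCoveringMap_nsmul_of_ne_zero (1 : ℝ)
    (m ^ k)).isCoveringMap.isLocalHomeomorph.isOpenMap

theorem norm_coe_le_abs (x : ℝ) : ‖(x : UnitAddCircle)‖ ≤ |x| := by
  rw [UnitAddCircle.norm_eq]
  simpa using round_le x 0

/-- The backward orbit of every point under `φ ↦ m φ` is dense. -/
theorem exists_mem_pow_nsmul_eq {m : ℕ} (hm : 2 ≤ m) (φ ψ₀ : UnitAddCircle)
    {U : Set UnitAddCircle} (hU : U ∈ 𝓝 ψ₀) : ∃ k ≥ 1, ∃ ψ ∈ U, m ^ k • ψ = φ := by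
  obtain ⟨ε, hε, hεU⟩ := Metric.mem_nhds_iff.1 hU
  have hm1 : (1 : ℝ) < m := by exact_mod_cast (by omega : 1 < m)
  obtain ⟨k, hk⟩ := exists_pow_lt_of_lt_one hε (inv_lt_one_of_one_lt₀ hm1)
  have hk' : ((m : ℝ)⁻¹) ^ (k + 1) < ε :=
    (pow_le_pow_of_le_one (by positivity) (inv_lt_one_of_one_lt₀ hm1).le (Nat.le_succ k)).trans_lt
      hk
  obtain ⟨s, hs⟩ := QuotientAddGroup.mk_surjective (φ - m ^ (k + 1) • ψ₀)
  have hs' : ((Int.fract s : ℝ) : UnitAddCircle) = φ - m ^ (k + 1) • ψ₀ := by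
    rw [← hs]
    refine (QuotientAddGroup.eq_iff_sub_mem).2 ⟨-⌊s⌋, ?_⟩
    rw [← Int.self_sub_floor]
    simp
  have hmk : (0 : ℝ) < (m : ℝ) ^ (k + 1) := by positivity
  refine ⟨k + 1, by omega, ψ₀ + ((Int.fract s / (m : ℝ) ^ (k + 1) : ℝ) : UnitAddCircle),
    hεU ?_, ?_⟩
  · rw [Metric.mem_ball, dist_eq_norm, add_sub_cancel_left]
    refine (norm_coe_le_abs _).trans_lt ?_
    rw [abs_of_nonneg (div_nonneg (Int.fract_nonneg _) hmk.le)]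
    refine lt_of_le_of_lt ?_ hk'
    rw [inv_pow, div_eq_mul_inv]
    exact mul_le_of_le_one_left (by positivity) (Int.fract_lt_one s).le
  · rw [smul_add, ← AddCircle.coe_nsmul, nsmul_eq_mul]
    push_cast
    rw [mul_div_cancel₀ _ hmk.ne', hs']
    abel

variable {n : ℕ}

/-- A continuous curve in `ℝⁿ`, not contained in a hyperplane, whose sum over the `m` preimages
of every point vanishes. The cancellation is obtained by telescoping, taking
`h(ψ) - h(ψ + 1/m)`. -/
theorem exists_meanZero_curve {m : ℕ} (hm : 2 ≤ m) (n : ℕ) :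
    ∃ c : C(UnitAddCircle, EuclideanSpace ℝ (Fin n)), (∀ φ, ‖c φ‖ ≤ 1 / 2) ∧
      (∀ ψ, ∑ j ∈ Finset.range m, c (ψ + ((j / m : ℝ) : UnitAddCircle)) = 0) ∧
      ∀ u ≠ 0, ∃ φ, ⟪u, c φ⟫ ≠ 0 := by
  have hm0 : (0 : ℝ) < m := by exact_mod_cast (by omega : 0 < m)
  have hm2 : (2 : ℝ) ≤ m := by exact_mod_cast hm
  -- `d` will take the `k`-th unit vector as its value at `q k`; the points `q i` and `q i + 1 / m`
  -- are pairwise distinct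
  let q : Fin n → ℝ := fun i => 1 / (m * (i + 2))
  have hq0 : ∀ i, 0 < q i := fun i => by positivity
  have hqlt : ∀ i, q i < 1 / m := fun i => by
    refine one_div_lt_one_div_of_lt hm0 ?_
    have : (0 : ℝ) ≤ (i : ℕ) := Nat.cast_nonneg _
    nlinarith
  have h2m : 1 / (m : ℝ) + 1 / m ≤ 1 := by
    rw [← add_div, div_le_one hm0]; linarith
  have hqinj : ∀ i j, q i = q j → i = j := by
    intro i j hij
    have h1 : (m : ℝ) * ((i : ℕ) + 2) = m * ((j : ℕ) + 2) := by
      have := congrArg (fun x => 1 / x) hij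
      simpa [q] using this
    have h2 : ((i : ℕ) : ℝ) = (j : ℕ) := by
      have := mul_left_cancel₀ hm0.ne' h1
      linarith
    exact Fin.ext (by exact_mod_cast h2)
  have hmem1 : ∀ i, q i ∈ Set.Ico (0 : ℝ) (0 + 1) := fun i =>
    ⟨(hq0 i).le, by have := hqlt i; have := one_div_pos.2 hm0; linarith⟩
  have hmem2 : ∀ i, q i + 1 / m ∈ Set.Ico (0 : ℝ) (0 + 1) := fun i =>
    ⟨by have := hq0 i; have := one_div_pos.2 hm0; linarith, by have := hqlt i; linarith⟩
  let S : Fin n → Set UnitAddCircle := fun i =>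
    (fun k => ((q k : ℝ) : UnitAddCircle)) '' {k | k ≠ i} ∪
      Set.range fun k => ((q k + 1 / m : ℝ) : UnitAddCircle)
  have hSfin : ∀ i, (S i).Finite := fun i => (Set.toFinite _).union (Set.toFinite _)
  have hSq : ∀ i, ((q i : ℝ) : UnitAddCircle) ∉ S i := by
    rintro i (⟨k, hk, hki⟩ | ⟨k, hki⟩)
    · exact hk (hqinj _ _ ((AddCircle.coe_eq_coe_iff_of_mem_Ico (hmem1 k) (hmem1 i)).1 hki))
    · have := (AddCircle.coe_eq_coe_iff_of_mem_Ico (hmem2 k) (hmem1 i)).1 hki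
      have h1 := hqlt i
      have h2 := hq0 k
      linarith
  choose h h0 h1 h01 using fun i => exists_continuous_zero_one_of_isClosed
    (hSfin i).isClosed (isClosed_singleton (x := ((q i : ℝ) : UnitAddCircle)))
    (Set.disjoint_singleton_right.2 (hSq i))
  let H : C(UnitAddCircle, EuclideanSpace ℝ (Fin n)) :=
    ⟨fun φ => WithLp.toLp 2 fun i => h i φ, by fun_prop⟩
  let d : C(UnitAddCircle, EuclideanSpace ℝ (Fin n)) :=
    ⟨fun φ => H φ - H (φ + ((1 / m : ℝ) : UnitAddCircle)), by fun_prop⟩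
  have hd : ∀ i k, d ((q k : ℝ) : UnitAddCircle) i = if k = i then 1 else 0 := by
    intro i k
    have e1 : d ((q k : ℝ) : UnitAddCircle) i = h i ((q k : ℝ) : UnitAddCircle) -
        h i ((q k + 1 / m : ℝ) : UnitAddCircle) := by
      simp [d, H]
    have e2 : h i ((q k + 1 / m : ℝ) : UnitAddCircle) = 0 := h0 i (Or.inr ⟨k, rfl⟩)
    rw [e1, e2, sub_zero]
    split_ifs with hki
    · subst hki; exact h1 k rfl
    · exact h0 i (Or.inl ⟨k, hki, rfl⟩)
  set s : ℝ := (2 * (‖d‖ + 1))⁻¹ with hs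
  have hs0 : 0 < s := by positivity
  refine ⟨s • d, fun φ => ?_, fun ψ => ?_, fun u hu => ?_⟩
  · rw [ContinuousMap.smul_apply, norm_smul, Real.norm_of_nonneg hs0.le, hs,
      inv_mul_le_iff₀ (by positivity)]
    have := d.norm_coe_le_norm φ
    linarith
  · have htel : ∀ j : ℕ, d (ψ + ((j / m : ℝ) : UnitAddCircle)) =
        H (ψ + ((j / m : ℝ) : UnitAddCircle)) -
          H (ψ + (((j + 1 : ℕ) / m : ℝ) : UnitAddCircle)) := by
      intro j
      simp only [d, ContinuousMap.coe_mk]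
      congr 2
      rw [add_assoc, ← AddCircle.coe_add]
      congr 2
      push_cast
      ring
    simp only [ContinuousMap.smul_apply, ← Finset.smul_sum, htel]
    rw [Finset.sum_range_sub' fun j : ℕ => H (ψ + ((j / m : ℝ) : UnitAddCircle))]
    have : (((m : ℕ) / m : ℝ) : UnitAddCircle) = 0 := by
      rw [div_self hm0.ne']; exact AddCircle.coe_period 1
    rw [this]
    simp
  · obtain ⟨k, hk⟩ : ∃ k, u k ≠ 0 := by
      by_contra hcon
      push Not at hcon
      exact hu (by ext k; simpa using hcon k)
    refine ⟨((q k : ℝ) : UnitAddCircle), ?_⟩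
    rw [ContinuousMap.smul_apply, inner_smul_right]
    refine mul_ne_zero hs0.ne' ?_
    rw [PiLp.inner_apply]
    simp only [hd]
    simpa using hk

variable {E : Type*} [NormedAddCommGroup E] [InnerProductSpace ℝ E]

/-- If the sums of `c` along backward orbits of `φ` never had a positive component along `u`, then,
as they average to zero, they would all be orthogonal to `u`, and so would `c` be on the dense
backward orbit of `φ`. -/
theorem exists_inner_sum_pos {m : ℕ} (hm : 2 ≤ m) {c : UnitAddCircle → E} (hc : Continuous c)
    (hmean : ∀ ψ, ∑ j ∈ Finset.range m, c (ψ + ((j / m : ℝ) : UnitAddCircle)) = 0)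
    {u : E} (hu : ∃ φ, ⟪u, c φ⟫ ≠ 0) (φ : UnitAddCircle) :
    ∃ k ≥ 1, ∃ ψ, m ^ k • ψ = φ ∧ 0 < ⟪u, ∑ i ∈ Finset.range k, c (m ^ i • ψ)⟫ := by
  by_contra hcon
  push Not at hcon
  have hm0 : (m : ℝ) ≠ 0 := by exact_mod_cast (by omega : m ≠ 0)
  have hmul : ∀ (j : ℕ) (ψ : UnitAddCircle), m • (ψ + ((j / m : ℝ) : UnitAddCircle)) = m • ψ := by
    intro j ψ
    rw [smul_add, ← AddCircle.coe_nsmul, nsmul_eq_mul, mul_div_cancel₀ _ hm0]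
    have : ((j : ℝ) : UnitAddCircle) = 0 := by
      rw [← mul_one (j : ℝ), ← nsmul_eq_mul, AddCircle.coe_nsmul, AddCircle.coe_period, smul_zero]
    rw [this, add_zero]
  have hsucc : ∀ (k : ℕ) (ψ : UnitAddCircle), ∑ i ∈ Finset.range (k + 1), c (m ^ i • ψ) =
      c ψ + ∑ i ∈ Finset.range k, c (m ^ i • (m • ψ)) := by
    intro k ψ
    rw [Finset.sum_range_succ', add_comm]
    simp [pow_succ, mul_smul]
  -- by induction on `k`, using the `m` preimages `ψ + j / m` of `m • ψ`
  have key : ∀ k : ℕ, ∀ ψ, m ^ k • ψ = φ → ⟪u, ∑ i ∈ Finset.range k, c (m ^ i • ψ)⟫ = 0 ∧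
      (1 ≤ k → ⟪u, c ψ⟫ = 0) := by
    intro k
    induction k with
    | zero => intro ψ _; simp
    | succ k ih =>
      intro ψ hψ
      have hle : ∀ j ∈ Finset.range m, ⟪u, c (ψ + ((j / m : ℝ) : UnitAddCircle))⟫ ≤ 0 := by
        intro j _
        have h1 := hcon (k + 1) (by omega) (ψ + ((j / m : ℝ) : UnitAddCircle)) (by
          rw [pow_succ, mul_smul, hmul, ← mul_smul, ← pow_succ, hψ])
        have h2 := (ih (m • ψ) (by rw [← mul_smul, ← pow_succ, hψ])).1
        rw [hsucc, hmul, inner_add_right, h2, add_zero] at h1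
        exact h1
      have hsum : ∑ j ∈ Finset.range m, ⟪u, c (ψ + ((j / m : ℝ) : UnitAddCircle))⟫ = 0 := by
        rw [← inner_sum, hmean, inner_zero_right]
      have h3 := (Finset.sum_eq_zero_iff_of_nonpos hle).1 hsum 0 (Finset.mem_range.2 (by omega))
      simp only [Nat.cast_zero, zero_div, AddCircle.coe_zero, add_zero] at h3
      refine ⟨?_, fun _ => h3⟩
      rw [hsucc, inner_add_right, h3, zero_add]
      exact (ih (m • ψ) (by rw [← mul_smul, ← pow_succ, hψ])).1
  obtain ⟨ψ₀, hψ₀⟩ := hu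
  have hopen : IsOpen {ψ | ⟪u, c ψ⟫ ≠ 0} :=
    isOpen_ne_fun (continuous_const.inner hc) continuous_const
  obtain ⟨k, hk, ψ, hψ, hψφ⟩ := exists_mem_pow_nsmul_eq hm φ ψ₀ (hopen.mem_nhds hψ₀)
  exact hψ ((key k ψ hψφ).2 hk)

/-- The previous lemma holds uniformly in the point and the direction. -/
theorem exists_forall_le_inner_sum [FiniteDimensional ℝ E] {m : ℕ} (hm : 2 ≤ m)
    {c : UnitAddCircle → E} (hc : Continuous c)
    (hmean : ∀ ψ, ∑ j ∈ Finset.range m, c (ψ + ((j / m : ℝ) : UnitAddCircle)) = 0)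
    (hspan : ∀ u ≠ 0, ∃ φ, ⟪u, c φ⟫ ≠ 0) :
    ∃ a > 0, ∃ K : ℕ, ∀ φ : UnitAddCircle, ∀ u : E, ‖u‖ = 1 → ∃ k ≥ 1, k ≤ K ∧
      ∃ ψ, m ^ k • ψ = φ ∧ a ≤ ⟪u, ∑ i ∈ Finset.range k, c (m ^ i • ψ)⟫ := by
  have hcomp : IsCompact ((Set.univ : Set UnitAddCircle) ×ˢ Metric.sphere (0 : E) 1) :=
    isCompact_univ.prod (isCompact_sphere _ _)
  have := hcomp.induction_on (p := fun S => ∃ a > 0, ∃ K : ℕ, ∀ z ∈ S, ∃ k ≥ 1, k ≤ K ∧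
      ∃ ψ, m ^ k • ψ = z.1 ∧ a ≤ ⟪z.2, ∑ i ∈ Finset.range k, c (m ^ i • ψ)⟫) ?_ ?_ ?_ ?_
  · obtain ⟨a, ha, K, h⟩ := this
    exact ⟨a, ha, K, fun φ u hu => h (φ, u) ⟨trivial, by simpa using hu⟩⟩
  · exact ⟨1, one_pos, 0, by simp⟩
  · rintro s t hst ⟨a, ha, K, h⟩
    exact ⟨a, ha, K, fun z hz => h z (hst hz)⟩
  · rintro s t ⟨a, ha, K, h⟩ ⟨a', ha', K', h'⟩
    refine ⟨min a a', lt_min ha ha', max K K', fun z hz => ?_⟩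
    rcases hz with hz | hz
    · obtain ⟨k, hk1, hkK, ψ, hψ, hle⟩ := h z hz
      exact ⟨k, hk1, hkK.trans (le_max_left _ _), ψ, hψ, (min_le_left _ _).trans hle⟩
    · obtain ⟨k, hk1, hkK, ψ, hψ, hle⟩ := h' z hz
      exact ⟨k, hk1, hkK.trans (le_max_right _ _), ψ, hψ, (min_le_right _ _).trans hle⟩
  · rintro ⟨φ, u⟩ ⟨-, hu⟩
    have hu1 : ‖u‖ = 1 := by simpa using hu
    have hu0 : u ≠ 0 := by rintro rfl; simp at hu1
    obtain ⟨k, hk1, ψ, hψ, hpos⟩ := exists_inner_sum_pos hm hc hmean (hspan u hu0) φ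
    set s := ⟪u, ∑ i ∈ Finset.range k, c (m ^ i • ψ)⟫
    have hcont : Continuous fun z : UnitAddCircle × E =>
        ⟪z.2, ∑ i ∈ Finset.range k, c (m ^ i • z.1)⟫ := by
      refine continuous_snd.inner (continuous_finsetSum _ fun i _ => hc.comp ?_)
      exact (continuous_const_smul _).comp continuous_fst
    have hnhds : {z : UnitAddCircle × E |
        s / 2 < ⟪z.2, ∑ i ∈ Finset.range k, c (m ^ i • z.1)⟫} ∈ 𝓝 (ψ, u) :=
      (isOpen_lt continuous_const hcont).mem_nhds (half_lt_self hpos)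
    have hop : IsOpenMap (Prod.map (fun φ : UnitAddCircle => m ^ k • φ) (id : E → E)) :=
      (isOpenMap_pow_nsmul hm k).prodMap IsOpenMap.id
    have himg := hop.image_mem_nhds hnhds
    simp only [Prod.map_apply, hψ, id] at himg
    refine ⟨_, mem_nhdsWithin_of_mem_nhds himg, s / 2, half_pos hpos, k, ?_⟩
    rintro _ ⟨⟨ψ', u'⟩, hz, rfl⟩
    exact ⟨k, hk1, le_rfl, ψ', rfl, le_of_lt hz⟩

end Steering

/-! ### Small pushes of Euclidean space -/

section Push

open scoped RealInnerProductSpace NNReal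

/-- Identity plus a Lipschitz map with constant less than one is a diffeomorphism. -/
theorem exists_homeomorph_id_add {E : Type*} [NormedAddCommGroup E] [NormedSpace ℝ E]
    [CompleteSpace E] {w : E → E} {K : ℝ≥0} (hw : ContDiff ℝ 1 w) (hK : LipschitzWith K w)
    (hK1 : K < 1) :
    ∃ h : E ≃ₜ E, (∀ x, h x = x + w x) ∧ ContDiff ℝ 1 h ∧ ContDiff ℝ 1 h.symm := by
  have happ : ApproximatesLinearOn (fun x => x + w x)
      ((ContinuousLinearEquiv.refl ℝ E : E ≃L[ℝ] E) : E →L[ℝ] E) Set.univ K := by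
    intro x _ y _
    have : x + w x - (y + w y) - ((ContinuousLinearEquiv.refl ℝ E : E ≃L[ℝ] E) : E →L[ℝ] E) (x - y)
        = w x - w y := by
      simp only [ContinuousLinearEquiv.coe_refl, ContinuousLinearMap.coe_id', id]; abel
    rw [this]
    exact hK.norm_sub_le x y
  have hc : Subsingleton E ∨ K <
      ‖((ContinuousLinearEquiv.refl ℝ E).symm : E →L[ℝ] E)‖₊⁻¹ := by
    rcases subsingleton_or_nontrivial E with h | h
    · exact Or.inl h
    · right
      have : ‖((ContinuousLinearEquiv.refl ℝ E).symm : E →L[ℝ] E)‖₊ = 1 := by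
        simp
      rw [this, inv_one]
      exact hK1
  let h : E ≃ₜ E := happ.toHomeomorph _ hc
  have hh : ∀ x, h x = x + w x := fun x => rfl
  have hcd : ContDiff ℝ 1 h := by
    have : (h : E → E) = fun x => x + w x := funext hh
    rw [this]
    exact contDiff_id.add hw
  have hnorm : ∀ x, ‖-fderiv ℝ w x‖ < 1 := fun x => by
    rw [norm_neg]
    exact (norm_fderiv_le_of_lipschitz ℝ hK).trans_lt (by exact_mod_cast hK1)
  refine ⟨h, hh, hcd, h.contDiff_symm
    (f₀' := fun x => ContinuousLinearEquiv.unitsEquiv ℝ E (Units.oneSub _ (hnorm x)))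
    (fun x => ?_) hcd⟩
  have h1 : HasFDerivAt (fun x => x + w x) (ContinuousLinearMap.id ℝ E + fderiv ℝ w x) x :=
    (hasFDerivAt_id x).add (hw.differentiable one_ne_zero x).hasFDerivAt
  have h2 : ((ContinuousLinearEquiv.unitsEquiv ℝ E (Units.oneSub _ (hnorm x)) : E ≃L[ℝ] E) :
      E →L[ℝ] E) = ContinuousLinearMap.id ℝ E + fderiv ℝ w x := by
    ext v
    simp [ContinuousLinearEquiv.unitsEquiv_apply]
  rw [h2]
  exact h1

variable {E : Type*} [NormedAddCommGroup E] [InnerProductSpace ℝ E] [FiniteDimensional ℝ E]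

variable (E) in
/-- A smooth function equal to one on the ball of radius 1 and to zero off the ball of radius 2. -/
noncomputable def cutoff : ContDiffBump (0 : E) := ⟨1, 2, one_pos, one_lt_two⟩

/-- The vector field `x ↦ c - x`, cut off outside the ball of radius 2. -/
noncomputable def drift (c x : E) : E := cutoff E x • (c - x)

/-- The time `ε` Euler step of the vector field `drift c`: on the unit ball, a contraction towards
the point `c`. -/
noncomputable def push (ε : ℝ) (c x : E) : E := x + ε • drift c x

theorem drift_of_norm_le_one (c : E) {x : E} (hx : ‖x‖ ≤ 1) : drift c x = c - x := by
  have : cutoff E x = 1 := (cutoff E).one_of_mem_closedBall (by simpa [cutoff] using hx)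
  rw [drift, this, one_smul]

theorem drift_of_two_le_norm (c : E) {x : E} (hx : 2 ≤ ‖x‖) : drift c x = 0 := by
  have : cutoff E x = 0 := (cutoff E).zero_of_le_dist (by simpa [cutoff] using hx)
  rw [drift, this, zero_smul]

theorem push_of_two_le_norm (ε : ℝ) (c : E) {x : E} (hx : 2 ≤ ‖x‖) : push ε c x = x := by
  rw [push, drift_of_two_le_norm c hx, smul_zero, add_zero]

theorem push_of_norm_le_one (ε : ℝ) (c : E) {x : E} (hx : ‖x‖ ≤ 1) :
    push ε c x = (1 - ε) • x + ε • c := by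
  rw [push, drift_of_norm_le_one c hx, smul_sub, sub_smul, one_smul]
  abel

theorem norm_push_lt_one {ε : ℝ} (hε : 0 < ε) (hε1 : ε ≤ 1) {c x : E} (hc : ‖c‖ ≤ 1 / 2)
    (hx : ‖x‖ ≤ 1) : ‖push ε c x‖ < 1 := by
  rw [push_of_norm_le_one ε c hx]
  refine (norm_add_le _ _).trans_lt ?_
  rw [norm_smul, norm_smul, Real.norm_of_nonneg (by linarith), Real.norm_of_nonneg hε.le]
  nlinarith [norm_nonneg x]

theorem norm_drift_le {c : E} (hc : ‖c‖ ≤ 1 / 2) (x : E) : ‖drift c x‖ ≤ 5 / 2 := by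
  rcases le_or_gt 2 ‖x‖ with hx | hx
  · rw [drift_of_two_le_norm c hx, norm_zero]; norm_num
  · rw [drift, norm_smul, Real.norm_of_nonneg (cutoff E).nonneg]
    have h1 : ‖c - x‖ ≤ 5 / 2 := (norm_sub_le _ _).trans (by linarith)
    nlinarith [(cutoff E).le_one (x := x), (cutoff E).nonneg (x := x), norm_nonneg (c - x)]

theorem contDiff_drift (c : E) : ContDiff ℝ 1 (drift c) :=
  (cutoff E).contDiff.smul (contDiff_const.sub contDiff_id)

theorem continuous_drift : Continuous fun z : E × E => drift z.1 z.2 :=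
  ((cutoff E).continuous.comp continuous_snd).smul (continuous_fst.sub continuous_snd)

theorem continuous_push (ε : ℝ) : Continuous fun z : E × E => push ε z.1 z.2 :=
  continuous_snd.add (continuous_drift.const_smul ε)

variable (E) in
theorem exists_lipschitzWith_drift :
    ∃ Λ : ℝ≥0, ∀ c : E, ‖c‖ ≤ 1 / 2 → LipschitzWith Λ (drift c) := by
  obtain ⟨L₁, hL₁⟩ := (cutoff E).contDiff (n := 1).lipschitzWith_of_hasCompactSupport
    (cutoff E).hasCompactSupport one_ne_zero
  have hcd : ContDiff ℝ 1 fun x : E => cutoff E x • x := (cutoff E).contDiff.smul contDiff_id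
  obtain ⟨L₂, hL₂⟩ := hcd.lipschitzWith_of_hasCompactSupport
    (cutoff E).hasCompactSupport.smul_right one_ne_zero
  refine ⟨L₁ + L₂, fun c hc => LipschitzWith.of_dist_le_mul fun x y => ?_⟩
  rw [dist_eq_norm]
  have h : drift c x - drift c y = (cutoff E x - cutoff E y) • c -
      (cutoff E x • x - cutoff E y • y) := by
    simp only [drift, smul_sub, sub_smul]; abel
  rw [h]
  refine (norm_sub_le _ _).trans ?_
  have h1 := hL₁.dist_le_mul x y
  have h2 : dist (cutoff E x • x) (cutoff E y • y) ≤ L₂ * dist x y := hL₂.dist_le_mul x y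
  rw [dist_eq_norm] at h1 h2
  rw [norm_smul]
  push_cast
  have h3 : ‖cutoff E x - cutoff E y‖ * ‖c‖ ≤ ‖cutoff E x - cutoff E y‖ * 1 :=
    mul_le_mul_of_nonneg_left (by linarith) (norm_nonneg _)
  linarith

variable (E) in
theorem exists_push_homeomorph : ∃ ε₀ > 0, ∀ ε : ℝ, 0 < ε → ε ≤ ε₀ → ∀ c : E, ‖c‖ ≤ 1 / 2 →
    ∃ h : E ≃ₜ E, (∀ x, h x = push ε c x) ∧ ContDiff ℝ 1 h ∧ ContDiff ℝ 1 h.symm := by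
  obtain ⟨Λ, hΛ⟩ := exists_lipschitzWith_drift E
  refine ⟨(2 * (Λ + 1))⁻¹, by positivity, fun ε hε hεle c hc => ?_⟩
  refine exists_homeomorph_id_add (w := fun x => ε • drift c x) (K := ‖ε‖₊ * Λ)
    ((contDiff_drift c).const_smul ε) ?_ ?_
  · exact LipschitzWith.of_dist_le_mul fun x y => by
      rw [dist_smul₀, NNReal.coe_mul, mul_assoc, coe_nnnorm]
      exact mul_le_mul_of_nonneg_left ((hΛ c hc).dist_le_mul x y) (norm_nonneg _)
  · rw [← NNReal.coe_lt_coe, NNReal.coe_mul, coe_nnnorm, Real.norm_of_nonneg hε.le]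
    push_cast
    have h0 : (0 : ℝ) ≤ Λ := Λ.2
    calc ε * Λ ≤ (2 * ((Λ : ℝ) + 1))⁻¹ * Λ := by gcongr
      _ < 1 := by
        rw [inv_mul_lt_iff₀ (by positivity)]; linarith

/-- Along an orbit of `k` pushes with small `ε`, the position at the beginning differs from the one
at the end `y` by `-ε ∑ (cⱼ - y)` up to terms of second order. If the sum of the `cⱼ` has a
component of size `a` in the direction of `y`, this brings the point closer to zero. -/
theorem norm_lt_of_push_orbit {Λ : ℝ≥0} (hΛ : ∀ c : E, ‖c‖ ≤ 1 / 2 → LipschitzWith Λ (drift c))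
    {a r ε : ℝ} {K k : ℕ} (ha : 0 < a) (hr : 0 < r) (hr1 : r ≤ 1) (hK : 1 ≤ K)
    (hKr : 2 * K * r ≤ a) (hε : 0 < ε) (hεr : 6 * ε ≤ r)
    (hεa : ε * (4 * (5 * K ^ 2 * Λ + 7 * K ^ 2)) < r * a) (hk : 1 ≤ k) (hkK : k ≤ K)
    {c : ℕ → E} (hc : ∀ j, ‖c j‖ ≤ 1 / 2) {x : ℕ → E}
    (hx : ∀ j < k, x (j + 1) = push ε (c j) (x j)) (hxr : ‖x k‖ ≤ r)
    (hdir : (k = 1 ∧ ‖x k‖ ≤ r / 2) ∨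
      (r / 2 ≤ ‖x k‖ ∧ a * ‖x k‖ ≤ ⟪x k, ∑ j ∈ Finset.range k, c j⟫)) :
    ‖x 0‖ < r := by
  set y := x k with hy
  have hK0 : (1 : ℝ) ≤ K := by exact_mod_cast hK
  have hkK' : (k : ℝ) ≤ K := by exact_mod_cast hkK
  have hΛ0 : (0 : ℝ) ≤ Λ := Λ.2
  -- each push moves a point by at most `5 / 2 * ε`, so the orbit stays close to its end
  have hclose : ∀ i ≤ k, ‖x (k - i) - y‖ ≤ i * (ε * (5 / 2)) := by
    intro i
    induction i with
    | zero => simp [hy]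
    | succ i ih =>
      intro hi
      have h1 := ih (by omega)
      have h2 := hx (k - (i + 1)) (by omega)
      rw [show k - (i + 1) + 1 = k - i by omega] at h2
      have h3 : x (k - (i + 1)) - y =
          (x (k - i) - y) - ε • drift (c (k - (i + 1))) (x (k - (i + 1))) := by
        rw [h2, push]; abel
      rw [h3]
      refine (norm_sub_le _ _).trans ?_
      rw [norm_smul, Real.norm_of_nonneg hε.le]
      have := norm_drift_le (hc (k - (i + 1))) (x (k - (i + 1)))
      push_cast
      nlinarith
  rcases hdir with ⟨rfl, hy2⟩ | ⟨hy2, hS⟩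
  · have h1 := hclose 1 le_rfl
    simp only [Nat.sub_self, Nat.cast_one, one_mul] at h1
    have : ‖x 0‖ ≤ ‖x 0 - y‖ + ‖y‖ := by simpa using norm_add_le (x 0 - y) y
    linarith
  set D := ∑ j ∈ Finset.range k, drift (c j) (x j) with hD
  set S := ∑ j ∈ Finset.range k, c j with hSdef
  have hx0 : x 0 = y - ε • D := by
    have h1 : ∑ j ∈ Finset.range k, (x (j + 1) - x j) = ε • D := by
      rw [hD, Finset.smul_sum]
      refine Finset.sum_congr rfl fun j hj => ?_
      rw [hx j (Finset.mem_range.1 hj), push]; abel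
    rw [Finset.sum_range_sub] at h1
    rw [← h1]; abel
  have hDle : ‖D‖ ≤ K * (5 / 2) := by
    refine (norm_sum_le _ _).trans ((Finset.sum_le_sum fun j _ => norm_drift_le (hc j) _).trans ?_)
    rw [Finset.sum_const, Finset.card_range, nsmul_eq_mul]
    nlinarith
  -- near `y` the drift is `c j - y` up to the Lipschitz error
  have hDS : ‖D - (S - (k : ℝ) • y)‖ ≤ K * (Λ * (K * (ε * (5 / 2)))) := by
    have h1 : D - (S - (k : ℝ) • y) =
        ∑ j ∈ Finset.range k, (drift (c j) (x j) - drift (c j) y) := by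
      rw [Finset.sum_sub_distrib, hD]
      congr 1
      simp only [drift_of_norm_le_one _ (hxr.trans hr1)]
      rw [Finset.sum_sub_distrib, Finset.sum_const, Finset.card_range, hSdef,
        Nat.cast_smul_eq_nsmul]
    rw [h1]
    refine (norm_sum_le _ _).trans ((Finset.sum_le_sum (g := fun _ => Λ * (K * (ε * (5 / 2))))
      fun j hj => ?_).trans ?_)
    · have hjk := Finset.mem_range.1 hj
      have h2 := (hΛ _ (hc j)).dist_le_mul (x j) y
      rw [dist_eq_norm, dist_eq_norm] at h2
      refine h2.trans (mul_le_mul_of_nonneg_left ?_ hΛ0)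
      have h3 := hclose (k - j) (by omega)
      rw [show k - (k - j) = j by omega] at h3
      refine h3.trans (mul_le_mul_of_nonneg_right ?_ (by positivity))
      exact_mod_cast (by omega : k - j ≤ K)
    · rw [Finset.sum_const, Finset.card_range, nsmul_eq_mul]
      exact mul_le_mul_of_nonneg_right hkK' (by positivity)
  have hinner : r * a / 4 - r * (K * (Λ * (K * (ε * (5 / 2))))) ≤ ⟪y, D⟫ := by
    have h1 : ⟪y, D⟫ = ⟪y, S⟫ - k * ‖y‖ ^ 2 + ⟪y, D - (S - (k : ℝ) • y)⟫ := by
      rw [inner_sub_right, inner_sub_right, inner_smul_right, real_inner_self_eq_norm_sq]; ring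
    have h2 : -(r * (K * (Λ * (K * (ε * (5 / 2)))))) ≤ ⟪y, D - (S - (k : ℝ) • y)⟫ := by
      have := (abs_le.1 (abs_real_inner_le_norm y (D - (S - (k : ℝ) • y)))).1
      have h3 := mul_le_mul hxr hDS (norm_nonneg _) hr.le
      linarith
    have h4 : r * a / 4 ≤ a * ‖y‖ - k * ‖y‖ ^ 2 := by
      have h5 : (k : ℝ) * ‖y‖ ≤ a / 2 := by
        have := mul_le_mul hkK' hxr (norm_nonneg y) (by positivity)
        linarith
      nlinarith [norm_nonneg y]
    linarith
  have hsq : ‖x 0‖ ^ 2 < r ^ 2 := by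
    rw [hx0, norm_sub_sq_real, inner_smul_right, norm_smul, Real.norm_of_nonneg hε.le]
    have h1 : ‖y‖ ^ 2 ≤ r ^ 2 := pow_le_pow_left₀ (norm_nonneg _) hxr 2
    have h2 : ‖D‖ ^ 2 ≤ (K * (5 / 2)) ^ 2 := pow_le_pow_left₀ (norm_nonneg _) hDle 2
    have h3 : r * (K * (Λ * (K * (ε * (5 / 2))))) ≤ 1 * (K * (Λ * (K * (ε * (5 / 2))))) :=
      mul_le_mul_of_nonneg_right hr1 (by positivity)
    have h4 : ε * (ε * (5 * K ^ 2 * Λ + 7 * K ^ 2)) < ε * (r * a / 4) :=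
      mul_lt_mul_of_pos_left (by linarith) hε
    have h5 : ε * (r * a / 4 - K * (Λ * (K * (ε * (5 / 2))))) ≤ ε * ⟪y, D⟫ :=
      mul_le_mul_of_nonneg_left (by linarith) hε.le
    have h6 : ε ^ 2 * ‖D‖ ^ 2 ≤ ε ^ 2 * (K * (5 / 2)) ^ 2 :=
      mul_le_mul_of_nonneg_left h2 (by positivity)
    have h7 : (0 : ℝ) ≤ ε ^ 2 * K ^ 2 := by positivity
    have h8 : (0 : ℝ) < ε * (r * a) := by positivity
    nlinarith
  exact lt_of_pow_lt_pow_left₀ 2 hr.le hsq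

/-- For a mean zero curve `c` not contained in a hyperplane and small `ε`, the skew product of the
pushes covers a whole cylinder `S¹ × {‖y‖ ≤ r}` by the images of its interior. -/
theorem exists_push_covering {m : ℕ} (hm : 2 ≤ m) {c : UnitAddCircle → E} (hc : Continuous c)
    (hc' : ∀ φ, ‖c φ‖ ≤ 1 / 2)
    (hmean : ∀ ψ, ∑ j ∈ Finset.range m, c (ψ + ((j / m : ℝ) : UnitAddCircle)) = 0)
    (hspan : ∀ u ≠ 0, ∃ φ, ⟪u, c φ⟫ ≠ 0) :
    ∃ r > 0, r < 1 ∧ ∃ ε₀ > 0, ε₀ < r ∧ ∀ ε : ℝ, 0 < ε → ε ≤ ε₀ → ∀ φ : UnitAddCircle, ∀ y : E,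
      ‖y‖ ≤ r → ∃ k ≥ 1, ∃ ψ, m ^ k • ψ = φ ∧ ∀ x : ℕ → E,
        (∀ j < k, x (j + 1) = push ε (c (m ^ j • ψ)) (x j)) → x k = y → ‖x 0‖ < r := by
  obtain ⟨Λ, hΛ⟩ := exists_lipschitzWith_drift E
  obtain ⟨a, ha, K', hK'⟩ := exists_forall_le_inner_sum hm hc hmean hspan
  set K := K' + 1 with hKdef
  have hK : 1 ≤ K := by omega
  have hK0 : (0 : ℝ) < K := by exact_mod_cast hK
  have hΛ0 : (0 : ℝ) ≤ Λ := Λ.2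
  set r := min (1 / 2) (a / (2 * K)) with hr
  have hr0 : 0 < r := lt_min (by norm_num) (by positivity)
  have hr1 : r ≤ 1 / 2 := min_le_left _ _
  have hKr : 2 * K * r ≤ a := by
    have : r ≤ a / (2 * K) := min_le_right _ _
    rwa [le_div_iff₀ (by positivity), mul_comm] at this
  set Q : ℝ := 4 * (5 * K ^ 2 * Λ + 7 * K ^ 2) with hQ
  have hQ0 : 0 < Q := by positivity
  refine ⟨r, hr0, by linarith, min (r / 6) (r * a / (2 * Q)), lt_min (by positivity)
    (by positivity), (min_le_left _ _).trans_lt (by linarith), fun ε hε hεle φ y hy => ?_⟩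
  have h6 : 6 * ε ≤ r := by
    have := hεle.trans (min_le_left _ _); linarith
  have hεQ : ε * Q < r * a := by
    have := hεle.trans (min_le_right _ _)
    rw [le_div_iff₀ (by positivity)] at this
    nlinarith [mul_pos hr0 ha]
  -- a point in the inner half of the ball is still in the ball one step earlier; otherwise the
  -- backward orbit is steered towards the centre
  rcases le_total ‖y‖ (r / 2) with hy2 | hy2
  · obtain ⟨k, hk, ψ, -, hψ⟩ := exists_mem_pow_nsmul_eq hm φ 0 Filter.univ_mem
    refine ⟨1, le_rfl, m ^ (k - 1) • ψ, ?_, fun x hx hxk => ?_⟩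
    · rw [← mul_smul, ← pow_add, Nat.add_sub_cancel' hk, hψ]
    · exact norm_lt_of_push_orbit hΛ ha hr0 (by linarith) hK hKr hε h6 hεQ le_rfl hK
        (fun j => hc' _) hx (hxk ▸ hy) (Or.inl ⟨rfl, hxk ▸ hy2⟩)
  · have hy0 : 0 < ‖y‖ := lt_of_lt_of_le (half_pos hr0) hy2
    obtain ⟨k, hk, hkK, ψ, hψ, hle⟩ := hK' φ (‖y‖⁻¹ • y) (by
      rw [norm_smul, norm_inv, norm_norm, inv_mul_cancel₀ hy0.ne'])
    refine ⟨k, hk, ψ, hψ, fun x hx hxk => ?_⟩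
    refine norm_lt_of_push_orbit hΛ ha hr0 (by linarith) hK hKr hε h6 hεQ hk (by omega)
      (fun j => hc' _) hx (hxk ▸ hy) (Or.inr ⟨hxk ▸ hy2, ?_⟩)
    rw [inner_smul_left, RCLike.conj_to_real, ← div_eq_inv_mul, le_div_iff₀ hy0] at hle
    rw [hxk]
    exact hle

end Push

/-! ### Charts given by linear functions of the embedding -/

section Chart

/-- The inverse function theorem near a point `a` at which the derivative is the identity, with the
domain shrunk into a given neighbourhood and with bounds on the derivative of the inverse. -/
theorem exists_openPartialHomeomorph_of_hasFDerivAt_id {E : Type*} [NormedAddCommGroup E]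
    [NormedSpace ℝ E] [CompleteSpace E] {f : E → E} {a : E} (hf : ContDiffAt ℝ 1 f a)
    (hf' : HasFDerivAt f (ContinuousLinearMap.id ℝ E) a) {S : Set E} (hS : S ∈ 𝓝 a) :
    ∃ (θ : OpenPartialHomeomorph E E) (C : ℝ), (θ : E → E) = f ∧ a ∈ θ.source ∧ θ.source ⊆ S ∧
      0 < C ∧ ∀ z ∈ θ.target, ContDiffAt ℝ 1 θ.symm z ∧ ‖fderiv ℝ θ.symm z‖ ≤ C := by
  have hf'' : HasFDerivAt f ((ContinuousLinearEquiv.refl ℝ E : E ≃L[ℝ] E) : E →L[ℝ] E) a := hf'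
  let θ₀ := hf.toOpenPartialHomeomorph f hf'' one_ne_zero
  have hcoe : (θ₀ : E → E) = f := rfl
  have ha : a ∈ θ₀.source := hf.mem_toOpenPartialHomeomorph_source hf'' one_ne_zero
  have hsymm : ContDiffAt ℝ 1 θ₀.symm (f a) := hf.to_localInverse hf'' one_ne_zero
  have h1 : ∀ᶠ z in 𝓝 (f a), ContDiffAt ℝ 1 θ₀.symm z := hsymm.eventually (by decide)
  have h2 : ∀ᶠ z in 𝓝 (f a), ‖fderiv ℝ θ₀.symm z‖ < ‖fderiv ℝ θ₀.symm (f a)‖ + 1 :=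
    (hsymm.continuousAt_fderiv one_ne_zero).norm.eventually (Iio_mem_nhds (lt_add_one _))
  have h3 : ∀ᶠ y in 𝓝 a, (ContDiffAt ℝ 1 θ₀.symm (f y) ∧
      ‖fderiv ℝ θ₀.symm (f y)‖ < ‖fderiv ℝ θ₀.symm (f a)‖ + 1) ∧ y ∈ S :=
    (hf.continuousAt.eventually (h1.and h2)).and hS
  obtain ⟨s, hsub, hso, has⟩ := eventually_nhds_iff.1 h3
  refine ⟨θ₀.restrOpen s hso, ‖fderiv ℝ θ₀.symm (f a)‖ + 1, hcoe, ⟨ha, has⟩,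
    fun y hy => (hsub y hy.2).2, by positivity, fun z hz => ?_⟩
  have hz' : z ∈ θ₀.target := by
    have := (θ₀.restrOpen s hso).map_target hz
    have h4 := θ₀.map_source this.1
    rwa [show θ₀ ((θ₀.restrOpen s hso).symm z) = z from
      (θ₀.restrOpen s hso).right_inv hz] at h4
  have h5 := (θ₀.restrOpen s hso).map_target hz
  have h6 := (hsub _ h5.2).1
  rw [show f ((θ₀.restrOpen s hso).symm z) = z from (θ₀.restrOpen s hso).right_inv hz] at h6
  exact ⟨h6.1, h6.2.le⟩

variable {n : ℕ} {M : Type*} [TopologicalSpace M] [ChartedSpace (EuclideanSpace ℝ (Fin n)) M]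

theorem fderiv_comp_extChartAt_symm {N : ℕ} {e : M → EuclideanSpace ℝ (Fin N)}
    (he : ContMDiff (𝓡 n) (𝓡 N) ∞ e) (p : M) (w : EuclideanSpace ℝ (Fin n)) :
    fderiv ℝ (fun y => e ((extChartAt (𝓡 n) p).symm y)) (extChartAt (𝓡 n) p p) w =
      mfderiv (𝓡 n) (𝓡 N) e p w := by
  rw [((he.mdifferentiable (by decide)) p).mfderiv, ModelWithCorners.range_eq_univ,
    fderivWithin_univ]
  rfl

variable [IsManifold (𝓡 n) ∞ M]

theorem contDiffAt_comp_extChartAt_symm {N : ℕ} {e : M → EuclideanSpace ℝ (Fin N)}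
    (he : ContMDiff (𝓡 n) (𝓡 N) ∞ e) (p : M) {y : EuclideanSpace ℝ (Fin n)}
    (hy : y ∈ (extChartAt (𝓡 n) p).target) :
    ContDiffAt ℝ 1 (fun y => e ((extChartAt (𝓡 n) p).symm y)) y := by
  have : IsManifold (𝓡 n) 1 M := IsManifold.of_le (n := ∞) (by decide)
  rw [← contMDiffAt_iff_contDiffAt]
  have h1 : ContMDiffOn (𝓡 n) (𝓡 n) 1 (extChartAt (𝓡 n) p).symm (extChartAt (𝓡 n) p).target :=
    contMDiffOn_extChartAt_symm p
  have h2 := h1.contMDiffAt ((isOpen_extChartAt_target p).mem_nhds hy)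
  exact ((he.of_le (by decide)).contMDiffAt (x := (extChartAt (𝓡 n) p).symm y)).comp y h2

open scoped Bundle in
/-- Near a point, the inverse of the preferred chart has bounded derivatives with respect to the
Riemannian metric `g`. -/
theorem exists_inner_mfderiv_symm_le
    (g : Bundle.ContMDiffRiemannianMetric (𝓡 n) ∞ (EuclideanSpace ℝ (Fin n))
      (fun x : M => TangentSpace (𝓡 n) x)) (p : M) :
    ∃ C > 0, ∀ᶠ y in 𝓝 (extChartAt (𝓡 n) p p), ∀ w : EuclideanSpace ℝ (Fin n),
      g.inner ((extChartAt (𝓡 n) p).symm y)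
        (mfderiv (𝓡 n) (𝓡 n) (extChartAt (𝓡 n) p).symm y w)
        (mfderiv (𝓡 n) (𝓡 n) (extChartAt (𝓡 n) p).symm y w) ≤ (C * ‖w‖) ^ 2 := by
  have : IsManifold (𝓡 n) 1 M := IsManifold.of_le (n := ∞) (by decide)
  let _ : Bundle.RiemannianBundle (fun x : M => TangentSpace (𝓡 n) x) := ⟨g.toRiemannianMetric⟩
  have : IsContinuousRiemannianBundle (EuclideanSpace ℝ (Fin n))
      (fun x : M => TangentSpace (𝓡 n) x) :=
    ⟨⟨g.inner, g.contMDiff.continuous, fun _ _ _ => rfl⟩⟩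
  obtain ⟨C, hC0, hC⟩ := eventually_norm_mfderivWithin_symm_extChartAt_lt (𝓡 n) p
  refine ⟨C, hC0, ?_⟩
  rw [ModelWithCorners.range_eq_univ, nhdsWithin_univ] at hC
  filter_upwards [hC] with y hy w
  rw [mfderivWithin_univ] at hy
  let T : EuclideanSpace ℝ (Fin n) →L[ℝ] TangentSpace (𝓡 n) ((extChartAt (𝓡 n) p).symm y) :=
    mfderiv (𝓡 n) (𝓡 n) (extChartAt (𝓡 n) p).symm y
  have h1 := (T.le_opNorm w).trans (mul_le_mul_of_nonneg_right hy.le (norm_nonneg w))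
  have h2 := pow_le_pow_left₀ (norm_nonneg _) h1 2
  rw [← real_inner_self_eq_norm_sq] at h2
  exact h2

/-- A local coordinate system of class `C¹` on `M` which is the restriction of an affine map
`L - b` under the embedding `e`, whose range contains the ball of radius 3 and whose inverse has
derivatives bounded by `C` with respect to the Riemannian metric. In such coordinates, the
derivative of a map `f` is `L` applied to the derivative of `e ∘ f`. -/
structure AffineChart (g : Bundle.ContMDiffRiemannianMetric (𝓡 n) ∞ (EuclideanSpace ℝ (Fin n))
      (fun x : M => TangentSpace (𝓡 n) x)) {N : ℕ} (e : M → EuclideanSpace ℝ (Fin N)) where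
  /-- the coordinate system -/
  q : OpenPartialHomeomorph M (EuclideanSpace ℝ (Fin n))
  /-- the linear part -/
  L : EuclideanSpace ℝ (Fin N) →L[ℝ] EuclideanSpace ℝ (Fin n)
  /-- the translation part -/
  b : EuclideanSpace ℝ (Fin n)
  /-- the bound on derivatives -/
  C : ℝ
  C_pos : 0 < C
  closedBall_subset : Metric.closedBall 0 3 ⊆ q.target
  apply_eq : ∀ x ∈ q.source, q x = L (e x) - b
  contMDiffOn_symm : ContMDiffOn (𝓡 n) (𝓡 n) 1 q.symm q.target
  inner_le : ∀ y ∈ q.target, ∀ w : EuclideanSpace ℝ (Fin n),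
    g.inner (q.symm y) (mfderiv (𝓡 n) (𝓡 n) q.symm y w) (mfderiv (𝓡 n) (𝓡 n) q.symm y w) ≤
      (C * ‖w‖) ^ 2

theorem nonempty_affineChart [Nonempty M]
    (g : Bundle.ContMDiffRiemannianMetric (𝓡 n) ∞ (EuclideanSpace ℝ (Fin n))
      (fun x : M => TangentSpace (𝓡 n) x)) {N : ℕ} {e : M → EuclideanSpace ℝ (Fin N)}
    (he : ContMDiff (𝓡 n) (𝓡 N) ∞ e)
    (he_imm : ∀ x : M, Function.Injective (mfderiv (𝓡 n) (𝓡 N) e x)) :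
    Nonempty (AffineChart g e) := by
  have : IsManifold (𝓡 n) 1 M := IsManifold.of_le (n := ∞) (by decide)
  obtain ⟨p⟩ := ‹Nonempty M›
  set κ := chartAt (EuclideanSpace ℝ (Fin n)) p with hκ
  set a := extChartAt (𝓡 n) p p with ha
  have hsymm : ⇑(extChartAt (𝓡 n) p).symm = κ.symm := by simp [hκ, mfld_simps]
  have haκ : a = κ p := by simp [ha, hκ, mfld_simps]
  have htarget : (extChartAt (𝓡 n) p).target = κ.target := by simp [hκ, mfld_simps]
  set ê : EuclideanSpace ℝ (Fin n) → EuclideanSpace ℝ (Fin N) := fun y => e (κ.symm y) with hê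
  have hêcd : ∀ y ∈ κ.target, ContDiffAt ℝ 1 ê y := by
    intro y hy
    have := contDiffAt_comp_extChartAt_symm he p (y := y) (by rwa [htarget])
    rwa [hsymm] at this
  have hat : a ∈ κ.target := by rw [haκ]; exact κ.map_source (mem_chart_source _ p)
  have hinj : Function.Injective (fderiv ℝ ê a) := by
    intro v w hvw
    have h1 := fderiv_comp_extChartAt_symm he p v
    have h2 := fderiv_comp_extChartAt_symm he p w
    rw [hsymm] at h1 h2
    exact he_imm p (h1.symm.trans (hvw.trans h2))
  -- a left inverse `P` of the derivative makes `P ∘ e` a local coordinate system near `p`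
  obtain ⟨P₀, hP₀⟩ := LinearMap.exists_leftInverse_of_injective
    (fderiv ℝ ê a : EuclideanSpace ℝ (Fin n) →ₗ[ℝ] EuclideanSpace ℝ (Fin N))
    (LinearMap.ker_eq_bot.2 hinj)
  let P : EuclideanSpace ℝ (Fin N) →L[ℝ] EuclideanSpace ℝ (Fin n) :=
    LinearMap.toContinuousLinearMap P₀
  set f : EuclideanSpace ℝ (Fin n) → EuclideanSpace ℝ (Fin n) := fun y => P (ê y) - P (e p)
  have hf : ContDiffAt ℝ 1 f a :=
    (P.contDiff.contDiffAt.comp a (hêcd a hat)).sub contDiffAt_const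
  have hf' : HasFDerivAt f (ContinuousLinearMap.id ℝ _) a := by
    have h1 := (P.hasFDerivAt.comp a
      ((hêcd a hat).differentiableAt one_ne_zero).hasFDerivAt).sub_const (P (e p))
    have h2 : P.comp (fderiv ℝ ê a) = ContinuousLinearMap.id ℝ _ := by
      ext1 v
      exact LinearMap.congr_fun hP₀ v
    rw [h2] at h1
    exact h1
  obtain ⟨C₁, hC₁, hbound⟩ := exists_inner_mfderiv_symm_le g p
  rw [hsymm] at hbound
  obtain ⟨θ, C₂, hθf, haθ, hθS, hC₂, hθ⟩ := exists_openPartialHomeomorph_of_hasFDerivAt_id hf hf'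
    (inter_mem (κ.open_target.mem_nhds hat) hbound)
  have hfa : θ a = 0 := by
    rw [hθf]
    simp [f, hê, haκ, κ.left_inv (mem_chart_source _ p)]
  have h0t : (0 : EuclideanSpace ℝ (Fin n)) ∈ θ.target := hfa ▸ θ.map_source haθ
  obtain ⟨δ, hδ, hball⟩ := Metric.isOpen_iff.1 θ.open_target 0 h0t
  have hs : (4 / δ) ≠ 0 := by positivity
  -- dilation by `s` makes the range contain the ball of radius 3
  set s := 4 / δ with hsdef
  have hs0 : 0 < s := by positivity
  set σ : EuclideanSpace ℝ (Fin n) ≃ₜ EuclideanSpace ℝ (Fin n) := Homeomorph.smulOfNeZero s hs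
  set q : OpenPartialHomeomorph M (EuclideanSpace ℝ (Fin n)) :=
    (κ.trans θ).trans σ.toOpenPartialHomeomorph with hq
  have hqsymm : ∀ y, q.symm y = κ.symm (θ.symm (s⁻¹ • y)) := fun y => rfl
  have hqt : ∀ y ∈ q.target, s⁻¹ • y ∈ θ.target := by
    intro y hy
    exact hy.2.1
  have hθs : ∀ z ∈ θ.target, θ.symm z ∈ κ.target ∧ ∀ w : EuclideanSpace ℝ (Fin n),
      g.inner (κ.symm (θ.symm z)) (mfderiv (𝓡 n) (𝓡 n) κ.symm (θ.symm z) w)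
        (mfderiv (𝓡 n) (𝓡 n) κ.symm (θ.symm z) w) ≤ (C₁ * ‖w‖) ^ 2 :=
    fun z hz => hθS (θ.map_target hz)
  have hinner : ∀ y ∈ q.target, ContDiffAt ℝ 1 (fun y => θ.symm (s⁻¹ • y)) y := fun y hy =>
    ((hθ _ (hqt y hy)).1).comp y (contDiff_const_smul s⁻¹).contDiffAt
  have hκcd : ∀ z ∈ κ.target, ContMDiffAt (𝓡 n) (𝓡 n) 1 κ.symm z := fun z hz =>
    (contMDiffOn_chart_symm (I := 𝓡 n) (n := 1) (x := p)).contMDiffAt (κ.open_target.mem_nhds hz)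
  refine ⟨⟨q, s • P, s • P (e p), C₁ * (C₂ * s⁻¹), by positivity, ?_, ?_, ?_, ?_⟩⟩
  · intro y hy
    have hy' : s⁻¹ • y ∈ θ.target := by
      apply hball
      rw [Metric.mem_closedBall, dist_zero_right] at hy
      rw [Metric.mem_ball, dist_zero_right, norm_smul, Real.norm_of_nonneg (by positivity),
        inv_mul_lt_iff₀ hs0, hsdef, div_mul_cancel₀ _ hδ.ne']
      linarith
    exact ⟨trivial, hy', (hθs _ hy').1⟩
  · intro x hx
    have hxκ : x ∈ κ.source := hx.1.1
    have : q x = s • θ (κ x) := rfl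
    rw [this, hθf]
    simp only [f, hê, κ.left_inv hxκ, smul_sub]
    rfl
  · intro y hy
    exact ((hκcd _ (hθs _ (hqt y hy)).1).comp y (hinner y hy).contMDiffAt).contMDiffWithinAt
  · intro y hy w
    have hz := hθs _ (hqt y hy)
    have hchain : mfderiv (𝓡 n) (𝓡 n) q.symm y =
        (mfderiv (𝓡 n) (𝓡 n) κ.symm (θ.symm (s⁻¹ • y))).comp
          (mfderiv (𝓡 n) (𝓡 n) (fun y => θ.symm (s⁻¹ • y)) y) :=
      mfderiv_comp y ((hκcd _ hz.1).mdifferentiableAt one_ne_zero)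
        ((hinner y hy).contMDiffAt.mdifferentiableAt one_ne_zero)
    rw [hchain, mfderiv_eq_fderiv]
    have hfd : ‖fderiv ℝ (fun y => θ.symm (s⁻¹ • y)) y w‖ ≤ C₂ * s⁻¹ * ‖w‖ := by
      have h1 : HasFDerivAt (fun y => θ.symm (s⁻¹ • y)) ((fderiv ℝ θ.symm (s⁻¹ • y)).comp
          (s⁻¹ • ContinuousLinearMap.id ℝ (EuclideanSpace ℝ (Fin n)))) y :=
        (((hθ _ (hqt y hy)).1).differentiableAt one_ne_zero).hasFDerivAt.comp y
          ((hasFDerivAt_id y).const_smul s⁻¹)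
      rw [h1.fderiv]
      simp only [ContinuousLinearMap.comp_apply, smul_apply,
        ContinuousLinearMap.id_apply]
      refine (ContinuousLinearMap.le_opNorm _ _).trans ?_
      rw [norm_smul, Real.norm_of_nonneg (by positivity), mul_assoc]
      exact mul_le_mul_of_nonneg_right (hθ _ (hqt y hy)).2 (by positivity)
    refine (hz.2 _).trans (pow_le_pow_left₀ (mul_nonneg hC₁.le (norm_nonneg _)) ?_ 2)
    rw [mul_assoc]
    exact mul_le_mul_of_nonneg_left hfd hC₁.le

end Chart

/-! ### Transplanting maps of Euclidean space to the manifold -/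

section Transplant

section BallHomeo

variable {E : Type*} [NormedAddCommGroup E] {h : E ≃ₜ E}

theorem norm_apply_le_two (hh : ∀ y, 2 ≤ ‖y‖ → h y = y) {y : E} (hy : ‖y‖ ≤ 2) :
    ‖h y‖ ≤ 2 := by
  by_contra! hcon
  have := h.injective (hh _ hcon.le)
  rw [this] at hcon
  linarith

theorem symm_apply_of_two_le_norm (hh : ∀ y, 2 ≤ ‖y‖ → h y = y) {y : E} (hy : 2 ≤ ‖y‖) :
    h.symm y = y := by
  rw [Homeomorph.symm_apply_eq, hh y hy]

theorem apply_mem_of_closedBall_subset (hh : ∀ y, 2 ≤ ‖y‖ → h y = y) {S : Set E}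
    (hS : Metric.closedBall 0 3 ⊆ S) {y : E} (hy : y ∈ S) : h y ∈ S := by
  rcases le_total 2 ‖y‖ with h2 | h2
  · rwa [hh y h2]
  · refine hS ?_
    rw [mem_closedBall_zero_iff]
    linarith [norm_apply_le_two hh h2]

end BallHomeo

variable {n : ℕ} {M : Type*} [TopologicalSpace M]

open scoped Classical in
/-- The map of `M` given by `h` in the coordinates `q`, and by the identity where these are not
defined. -/
noncomputable def transplant (q : OpenPartialHomeomorph M (EuclideanSpace ℝ (Fin n)))
    (h : EuclideanSpace ℝ (Fin n) → EuclideanSpace ℝ (Fin n)) (x : M) : M :=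
  if x ∈ q.source then q.symm (h (q x)) else x

variable {q : OpenPartialHomeomorph M (EuclideanSpace ℝ (Fin n))}

theorem transplant_symm_apply (h : EuclideanSpace ℝ (Fin n) → EuclideanSpace ℝ (Fin n))
    {y : EuclideanSpace ℝ (Fin n)} (hy : y ∈ q.target) :
    transplant q h (q.symm y) = q.symm (h y) := by
  rw [transplant, if_pos (q.map_target hy), q.right_inv hy]

theorem transplant_of_mem (h : EuclideanSpace ℝ (Fin n) → EuclideanSpace ℝ (Fin n))
    {x : M} (hx : x ∈ q.source) : transplant q h x = q.symm (h (q x)) := if_pos hx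

theorem transplant_of_notMem_image {h : EuclideanSpace ℝ (Fin n) → EuclideanSpace ℝ (Fin n)}
    (hh : ∀ y, 2 ≤ ‖y‖ → h y = y) {x : M} (hx : x ∉ q.symm '' Metric.closedBall 0 2) :
    transplant q h x = x := by
  by_cases hxs : x ∈ q.source
  · rw [transplant_of_mem h hxs, hh, q.left_inv hxs]
    by_contra! hcon
    exact hx ⟨q x, by simpa using hcon.le, q.left_inv hxs⟩
  · exact if_neg hxs

theorem isCompact_symm_image {S : Set (EuclideanSpace ℝ (Fin n))} (hS : IsCompact S)
    (hSt : S ⊆ q.target) : IsCompact (q.symm '' S) :=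
  hS.image_of_continuousOn (q.continuousOn_symm.mono hSt)

theorem isOpen_symm_image {S : Set (EuclideanSpace ℝ (Fin n))} (hS : IsOpen S)
    (hSt : S ⊆ q.target) : IsOpen (q.symm '' S) :=
  q.isOpen_image_symm_of_subset_target hS hSt

theorem transplant_transplant {h h' : EuclideanSpace ℝ (Fin n) → EuclideanSpace ℝ (Fin n)}
    (hmaps : ∀ y ∈ q.target, h y ∈ q.target) (hinv : ∀ y, h' (h y) = y) (x : M) :
    transplant q h' (transplant q h x) = x := by
  by_cases hx : x ∈ q.source
  · rw [transplant_of_mem h hx, transplant_symm_apply h' (hmaps _ (q.map_source hx)), hinv,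
      q.left_inv hx]
  · rw [show transplant q h x = x from if_neg hx]
    exact if_neg hx

theorem continuous_transplant [T2Space M] (hball : Metric.closedBall 0 3 ⊆ q.target)
    {Φ : Type*} [TopologicalSpace Φ]
    {h : Φ → EuclideanSpace ℝ (Fin n) → EuclideanSpace ℝ (Fin n)}
    (hh : ∀ φ y, 2 ≤ ‖y‖ → h φ y = y)
    (hmaps : ∀ φ, ∀ y ∈ q.target, h φ y ∈ q.target)
    (hcont : Continuous fun z : Φ × EuclideanSpace ℝ (Fin n) => h z.1 z.2) :
    Continuous fun z : Φ × M => transplant q (h z.1) z.2 := by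
  have hball2 : Metric.closedBall 0 2 ⊆ q.target :=
    (Metric.closedBall_subset_closedBall (by norm_num)).trans hball
  have hclosed : IsClosed (q.symm '' Metric.closedBall 0 2) :=
    (isCompact_symm_image (isCompact_closedBall _ _) hball2).isClosed
  refine continuous_iff_continuousAt.2 fun ⟨φ, x⟩ => ?_
  by_cases hx : x ∈ q.source
  · have h1 : ContinuousAt (fun z : Φ × M => q.symm (h z.1 (q z.2))) (φ, x) := by
      have h2 : ContinuousAt q.symm (h φ (q x)) :=
        q.continuousAt_symm (hmaps φ _ (q.map_source hx))
      have h3 : ContinuousAt (fun z : Φ × M => (z.1, q z.2)) (φ, x) :=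
        continuousAt_fst.prodMk ((q.continuousAt hx).comp (f := Prod.snd) continuousAt_snd)
      have h4 : ContinuousAt (fun z : Φ × M => h z.1 (q z.2)) (φ, x) :=
        ContinuousAt.comp (g := fun z : Φ × EuclideanSpace ℝ (Fin n) => h z.1 z.2)
          hcont.continuousAt h3
      exact ContinuousAt.comp (g := q.symm) h2 h4
    refine h1.congr ?_
    filter_upwards [(q.open_source.preimage continuous_snd).mem_nhds (x := (φ, x)) hx] with z hz
    exact (transplant_of_mem _ hz).symm
  · have hxK : x ∉ q.symm '' Metric.closedBall 0 2 := by
      rintro ⟨y, hy, rfl⟩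
      exact hx (q.map_target (hball2 hy))
    refine (continuousAt_snd : ContinuousAt Prod.snd (φ, x)).congr ?_
    filter_upwards [(hclosed.isOpen_compl.preimage continuous_snd).mem_nhds (x := (φ, x)) hxK]
      with z hz
    exact (transplant_of_notMem_image (hh _) hz).symm

variable [ChartedSpace (EuclideanSpace ℝ (Fin n)) M]

theorem contMDiff_transplant [T2Space M] (hball : Metric.closedBall 0 3 ⊆ q.target)
    (hq : ContMDiffOn (𝓡 n) (𝓡 n) 1 q q.source)
    (hq' : ContMDiffOn (𝓡 n) (𝓡 n) 1 q.symm q.target)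
    {h : EuclideanSpace ℝ (Fin n) → EuclideanSpace ℝ (Fin n)}
    (hh : ∀ y, 2 ≤ ‖y‖ → h y = y) (hmaps : ∀ y ∈ q.target, h y ∈ q.target)
    (hcont : ContDiff ℝ 1 h) : ContMDiff (𝓡 n) (𝓡 n) 1 (transplant q h) := by
  have hball2 : Metric.closedBall 0 2 ⊆ q.target :=
    (Metric.closedBall_subset_closedBall (by norm_num)).trans hball
  have hclosed : IsClosed (q.symm '' Metric.closedBall 0 2) :=
    (isCompact_symm_image (isCompact_closedBall _ _) hball2).isClosed
  intro x
  by_cases hx : x ∈ q.source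
  · have h1 : ContMDiffAt (𝓡 n) (𝓡 n) 1 (fun x => q.symm (h (q x))) x := by
      have h2 : ContMDiffAt (𝓡 n) (𝓡 n) 1 q.symm (h (q x)) :=
        hq'.contMDiffAt (q.open_target.mem_nhds (hmaps _ (q.map_source hx)))
      have h3 : ContMDiffAt (𝓡 n) (𝓡 n) 1 q x := hq.contMDiffAt (q.open_source.mem_nhds hx)
      have h4 : ContMDiffAt (𝓡 n) (𝓡 n) 1 (fun x => h (q x)) x :=
        (hcont.contMDiff (q x)).comp x h3
      exact ContMDiffAt.comp (g := q.symm) x h2 h4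
    refine h1.congr_of_eventuallyEq ?_
    filter_upwards [q.open_source.mem_nhds hx] with z hz
    exact transplant_of_mem _ hz
  · have hxK : x ∉ q.symm '' Metric.closedBall 0 2 := by
      rintro ⟨y, hy, rfl⟩
      exact hx (q.map_target (hball2 hy))
    refine (contMDiffAt_id (x := x)).congr_of_eventuallyEq ?_
    filter_upwards [hclosed.isOpen_compl.mem_nhds hxK] with z hz
    exact transplant_of_notMem_image hh hz

/-- The diffeomorphism of `M` given by `h` in the coordinates `q` and by the identity elsewhere. -/
noncomputable def transplantDiffeomorph [T2Space M] (hball : Metric.closedBall 0 3 ⊆ q.target)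
    (hq : ContMDiffOn (𝓡 n) (𝓡 n) 1 q q.source)
    (hq' : ContMDiffOn (𝓡 n) (𝓡 n) 1 q.symm q.target)
    (h : EuclideanSpace ℝ (Fin n) ≃ₜ EuclideanSpace ℝ (Fin n))
    (hh : ∀ y, 2 ≤ ‖y‖ → h y = y) (hcont : ContDiff ℝ 1 h) (hcont' : ContDiff ℝ 1 h.symm) :
    Diffeomorph (𝓡 n) (𝓡 n) M M 1 where
  toFun := transplant q h
  invFun := transplant q h.symm
  left_inv := transplant_transplant (fun _ hy => apply_mem_of_closedBall_subset hh hball hy)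
    h.symm_apply_apply
  right_inv := transplant_transplant (fun _ hy => apply_mem_of_closedBall_subset
    (fun _ => symm_apply_of_two_le_norm hh) hball hy) h.apply_symm_apply
  contMDiff_toFun := contMDiff_transplant hball hq hq' hh
    (fun _ hy => apply_mem_of_closedBall_subset hh hball hy) hcont
  contMDiff_invFun := contMDiff_transplant hball hq hq' (fun _ => symm_apply_of_two_le_norm hh)
    (fun _ hy => apply_mem_of_closedBall_subset (fun _ => symm_apply_of_two_le_norm hh) hball hy)
    hcont'

/-- The skew product with fiber maps `push ε (c φ)` in the coordinates `q`. -/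
theorem exists_skewProduct_push [T2Space M] (hball : Metric.closedBall 0 3 ⊆ q.target)
    (hq : ContMDiffOn (𝓡 n) (𝓡 n) 1 q q.source)
    (hq' : ContMDiffOn (𝓡 n) (𝓡 n) 1 q.symm q.target) {ε : ℝ}
    {c : UnitAddCircle → EuclideanSpace ℝ (Fin n)} (hc : Continuous c)
    (hpush : ∀ φ, ∃ h : EuclideanSpace ℝ (Fin n) ≃ₜ EuclideanSpace ℝ (Fin n),
      (∀ x, h x = push ε (c φ) x) ∧ ContDiff ℝ 1 h ∧ ContDiff ℝ 1 h.symm) :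
    ∃ F : SkewProduct n M, ∀ φ, ∀ y ∈ q.target,
      F.fiber φ (q.symm y) = q.symm (push ε (c φ) y) ∧ ∃ y' ∈ q.target, push ε (c φ) y' = y := by
  choose h hpush hcd hcd' using hpush
  have hh : ∀ φ y, 2 ≤ ‖y‖ → h φ y = y := fun φ y hy => by
    rw [hpush, push_of_two_le_norm ε _ hy]
  refine ⟨⟨fun φ => transplantDiffeomorph hball hq hq' (h φ) (hh φ) (hcd φ) (hcd' φ), ?_⟩, ?_⟩
  · refine continuous_transplant hball hh
      (fun φ y hy => apply_mem_of_closedBall_subset (hh φ) hball hy) ?_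
    simp only [hpush]
    exact (continuous_push ε).comp ((hc.comp continuous_fst).prodMk continuous_snd)
  · intro φ y hy
    refine ⟨?_, (h φ).symm y, apply_mem_of_closedBall_subset
      (fun _ => symm_apply_of_two_le_norm (hh φ)) hball hy, ?_⟩
    · rw [← hpush]
      exact transplant_symm_apply _ hy
    · rw [← hpush, Homeomorph.apply_symm_apply]

end Transplant

/-! ### Skew products and their perturbations -/

section Perturbation

variable {n : ℕ} {M : Type*} [TopologicalSpace M] [ChartedSpace (EuclideanSpace ℝ (Fin n)) M]

namespace SkewProduct

/-- The homeomorphism `(φ, x) ↦ (φ, f_φ(x))`. -/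
noncomputable def fiberHomeomorph [CompactSpace M] [T2Space M] (F : SkewProduct n M) :
    UnitAddCircle × M ≃ₜ UnitAddCircle × M :=
  Continuous.homeoOfEquivCompactToT2
    (f := { toFun := fun p => (p.1, F.fiber p.1 p.2)
            invFun := fun p => (p.1, (F.fiber p.1).symm p.2)
            left_inv := fun p => by simp
            right_inv := fun p => by simp })
    (continuous_fst.prodMk F.continuous_fiber)

theorem continuous_fiber_symm [CompactSpace M] [T2Space M] (F : SkewProduct n M) :
    Continuous fun p : UnitAddCircle × M => (F.fiber p.1).symm p.2 :=
  continuous_snd.comp F.fiberHomeomorph.symm.continuous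

theorem continuous_toMap (m : ℕ) (F : SkewProduct n M) : Continuous (F.toMap m) :=
  ((continuous_const_smul m).comp continuous_fst).prodMk F.continuous_fiber

theorem isOpenMap_toMap [CompactSpace M] [T2Space M] {m : ℕ} (hm : 2 ≤ m) (F : SkewProduct n M) :
    IsOpenMap (F.toMap m) := by
  have h1 := isOpenMap_pow_nsmul hm 1
  rw [pow_one] at h1
  exact (h1.prodMap IsOpenMap.id).comp F.fiberHomeomorph.isOpenMap

/-- The composition of the inverse fiber maps of `F` along the orbit segment
`ψ, mψ, …, mᵏ⁻¹ψ`: the point `x` of the fiber over `mᵏψ` is the image of `F.back m k ψ x` under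
the `k`-th iterate of `F`. -/
noncomputable def back (m : ℕ) (F : SkewProduct n M) : ℕ → UnitAddCircle → M → M
  | 0, _, x => x
  | k + 1, ψ, x => (F.fiber ψ).symm (back m F k (m • ψ) x)

theorem iterate_toMap_back (m : ℕ) (F : SkewProduct n M) (k : ℕ) (ψ : UnitAddCircle) (x : M) :
    (F.toMap m)^[k] (ψ, F.back m k ψ x) = (m ^ k • ψ, x) := by
  induction k generalizing ψ with
  | zero => simp [back]
  | succ k ih =>
    rw [Function.iterate_succ_apply]
    have : F.toMap m (ψ, F.back m (k + 1) ψ x) = (m • ψ, F.back m k (m • ψ) x) := by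
      simp [toMap, back]
    rw [this, ih, pow_succ, mul_smul]

variable [IsManifold (𝓡 n) ∞ M] {N : ℕ}
  {g : Bundle.ContMDiffRiemannianMetric (𝓡 n) ∞ (EuclideanSpace ℝ (Fin n))
    (fun x : M => TangentSpace (𝓡 n) x)}
  {e : M → EuclideanSpace ℝ (Fin N)}

/-- The distance between two skew products. -/
noncomputable def c1Edist
    (g : Bundle.ContMDiffRiemannianMetric (𝓡 n) ∞ (EuclideanSpace ℝ (Fin n))
      (fun x : M => TangentSpace (𝓡 n) x))
    (e : M → EuclideanSpace ℝ (Fin N)) (F G : SkewProduct n M) : ℝ≥0∞ :=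
  (SkewProduct.c1Metric g e).edist F G

/-- The neighbourhoods of a skew product. -/
noncomputable def c1Nhds
    (g : Bundle.ContMDiffRiemannianMetric (𝓡 n) ∞ (EuclideanSpace ℝ (Fin n))
      (fun x : M => TangentSpace (𝓡 n) x))
    (e : M → EuclideanSpace ℝ (Fin N)) (F : SkewProduct n M) : Filter (SkewProduct n M) :=
  @nhds _ (SkewProduct.c1Topology g e) F

theorem tendsto_c1Edist (F : SkewProduct n M) :
    Tendsto (fun G => c1Edist g e G F) (c1Nhds g e F) (𝓝 0) := by
  let _ := SkewProduct.c1Metric (n := n) g e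
  exact tendsto_iff_edist_tendsto_0.1 (tendsto_id (x := 𝓝 F))

theorem c1Dist_fiber_le (F G : SkewProduct n M) (φ : UnitAddCircle) :
    c1Dist g e (G.fiber φ) (F.fiber φ) ≤ c1Edist g e G F :=
  le_iSup_of_le (f := fun φ => max (c1Dist g e (G.fiber φ) (F.fiber φ))
    (c1Dist g e (G.fiber φ).symm (F.fiber φ).symm)) φ (le_max_left _ _)

theorem c1Dist_fiber_symm_le (F G : SkewProduct n M) (φ : UnitAddCircle) :
    c1Dist g e (G.fiber φ).symm (F.fiber φ).symm ≤ c1Edist g e G F :=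
  le_iSup_of_le (f := fun φ => max (c1Dist g e (G.fiber φ) (F.fiber φ))
    (c1Dist g e (G.fiber φ).symm (F.fiber φ).symm)) φ (le_max_right _ _)

theorem edist_le_c1Dist (f₁ f₂ : M → M) (x : M) :
    edist (e (f₁ x)) (e (f₂ x)) ≤ c1Dist g e f₁ f₂ :=
  le_add_right (le_iSup (fun x => edist (e (f₁ x)) (e (f₂ x))) x)

theorem edist_mvfderiv_le_c1Dist (f₁ f₂ : M → M) (x : M) (v : TangentSpace (𝓡 n) x)
    (hv : g.inner x v v ≤ 1) :
    edist (mvfderiv (𝓡 n) (e ∘ f₁) x v) (mvfderiv (𝓡 n) (e ∘ f₂) x v) ≤ c1Dist g e f₁ f₂ :=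
  le_add_left (le_iSup_of_le x (le_iSup_of_le v (le_iSup_of_le hv le_rfl)))

/-- Joint continuity at a given skew product `F` of a family of maps `u G φ` of the fibers
whose uniform distance is controlled by that of the skew products. -/
theorem tendsto_of_edist_le (he : IsInducing e) {F : SkewProduct n M}
    {u : SkewProduct n M → UnitAddCircle → M → M}
    (hu : ∀ G φ x, edist (e (u G φ x)) (e (u F φ x)) ≤ c1Edist g e G F)
    (hF : Continuous fun p : UnitAddCircle × M => u F p.1 p.2) (p : UnitAddCircle × M) :
    Tendsto (fun z : SkewProduct n M × UnitAddCircle × M => u z.1 z.2.1 z.2.2)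
      (c1Nhds g e F ×ˢ 𝓝 p) (𝓝 (u F p.1 p.2)) := by
  rw [he.tendsto_nhds_iff, tendsto_iff_edist_tendsto_0]
  have h1 : Tendsto (fun z : SkewProduct n M × UnitAddCircle × M => c1Edist g e z.1 F)
      (c1Nhds g e F ×ˢ 𝓝 p) (𝓝 0) := (tendsto_c1Edist F).comp tendsto_fst
  have h2 : Tendsto (fun z : SkewProduct n M × UnitAddCircle × M =>
      edist (e (u F z.2.1 z.2.2)) (e (u F p.1 p.2))) (c1Nhds g e F ×ˢ 𝓝 p) (𝓝 0) := by
    have h3 : Tendsto (fun z : UnitAddCircle × M => e (u F z.1 z.2)) (𝓝 p)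
        (𝓝 (e (u F p.1 p.2))) := (he.continuous.comp hF).tendsto p
    exact (tendsto_iff_edist_tendsto_0.1 h3).comp tendsto_snd
  have h3 := h1.add h2
  rw [add_zero] at h3
  refine tendsto_of_tendsto_of_tendsto_of_le_of_le tendsto_const_nhds h3 (fun _ => zero_le)
    fun z => ?_
  exact (edist_triangle _ (e (u F z.2.1 z.2.2)) _).trans (add_le_add (hu _ _ _) le_rfl)

theorem tendsto_fiber (he : IsInducing e) (F : SkewProduct n M) (p : UnitAddCircle × M) :
    Tendsto (fun z : SkewProduct n M × UnitAddCircle × M => z.1.fiber z.2.1 z.2.2)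
      (c1Nhds g e F ×ˢ 𝓝 p) (𝓝 (F.fiber p.1 p.2)) :=
  tendsto_of_edist_le (u := fun G φ x => G.fiber φ x) he
    (fun G φ x => (edist_le_c1Dist _ _ x).trans (c1Dist_fiber_le F G φ)) F.continuous_fiber p

theorem tendsto_fiber_symm [CompactSpace M] [T2Space M] (he : IsInducing e) (F : SkewProduct n M)
    (p : UnitAddCircle × M) :
    Tendsto (fun z : SkewProduct n M × UnitAddCircle × M => (z.1.fiber z.2.1).symm z.2.2)
      (c1Nhds g e F ×ˢ 𝓝 p) (𝓝 ((F.fiber p.1).symm p.2)) :=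
  tendsto_of_edist_le (u := fun G φ x => (G.fiber φ).symm x) he
    (fun G φ x => (edist_le_c1Dist _ _ x).trans (c1Dist_fiber_symm_le F G φ))
    F.continuous_fiber_symm p

theorem tendsto_back [CompactSpace M] [T2Space M] (he : IsInducing e) (m : ℕ)
    (F : SkewProduct n M) (k : ℕ) (p : UnitAddCircle × M) :
    Tendsto (fun z : SkewProduct n M × UnitAddCircle × M => z.1.back m k z.2.1 z.2.2)
      (c1Nhds g e F ×ˢ 𝓝 p) (𝓝 (F.back m k p.1 p.2)) := by
  induction k generalizing p with
  | zero => exact (continuous_snd.tendsto p).comp tendsto_snd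
  | succ k ih =>
    have h1 : Tendsto (fun z : SkewProduct n M × UnitAddCircle × M => (z.1, m • z.2.1, z.2.2))
        (c1Nhds g e F ×ˢ 𝓝 p) (c1Nhds g e F ×ˢ 𝓝 (m • p.1, p.2)) := by
      refine tendsto_fst.prodMk (Tendsto.comp (y := 𝓝 p)
        (g := fun z : UnitAddCircle × M => (m • z.1, z.2)) ?_ tendsto_snd)
      exact (((continuous_const_smul m).comp continuous_fst).prodMk continuous_snd).tendsto p
    have h2 := (ih (m • p.1, p.2)).comp h1
    have h3 : Tendsto (fun z : SkewProduct n M × UnitAddCircle × M => z.2.1)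
        (c1Nhds g e F ×ˢ 𝓝 p) (𝓝 p.1) := (continuous_fst.tendsto p).comp tendsto_snd
    exact (tendsto_fiber_symm he F (p.1, F.back m k (m • p.1) p.2)).comp
      (tendsto_fst.prodMk (h3.prodMk_nhds h2))

/-- Mapping a compact set fiberwise into an open set is an open condition. -/
theorem eventually_fiber_mem (he : IsInducing e) {F : SkewProduct n M} {K U : Set M}
    (hK : IsCompact K) (hU : IsOpen U) (h : ∀ φ, ∀ x ∈ K, F.fiber φ x ∈ U) :
    ∀ᶠ G in c1Nhds g e F, ∀ φ, ∀ x ∈ K, G.fiber φ x ∈ U := by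
  have hcomp : IsCompact ((Set.univ : Set UnitAddCircle) ×ˢ K) := isCompact_univ.prod hK
  have := hcomp.induction_on (p := fun S => ∀ᶠ G in c1Nhds g e F, ∀ z ∈ S, G.fiber z.1 z.2 ∈ U)
    (by simp) (fun s t hst ht => ht.mono fun G hG z hz => hG z (hst hz))
    (fun s t hs ht => (hs.and ht).mono fun G hG z hz => hz.elim (hG.1 z) (hG.2 z))
    (fun z hz => ?_)
  · exact this.mono fun G hG φ x hx => hG (φ, x) ⟨trivial, hx⟩
  · obtain ⟨pa, hpa, pb, hpb, hab⟩ := eventually_prod_iff.1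
      ((tendsto_fiber he F z).eventually (hU.mem_nhds (h z.1 z.2 hz.2)))
    exact ⟨{z | pb z}, mem_nhdsWithin_of_mem_nhds hpb, hpa.mono fun G hG z hz => hab hG hz⟩

/-- The covering of a compact cylinder by the images of an open one is an open condition. -/
theorem eventually_exists_back_mem [CompactSpace M] [T2Space M] (he : IsInducing e) {m : ℕ}
    (hm : 2 ≤ m) {F : SkewProduct n M} {K U : Set M} (hK : IsCompact K) (hU : IsOpen U)
    (h : ∀ φ, ∀ x ∈ K, ∃ k ≥ 1, ∃ ψ, m ^ k • ψ = φ ∧ F.back m k ψ x ∈ U) :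
    ∀ᶠ G in c1Nhds g e F, ∀ φ, ∀ x ∈ K, ∃ k ≥ 1, ∃ ψ, m ^ k • ψ = φ ∧ G.back m k ψ x ∈ U := by
  have hcomp : IsCompact ((Set.univ : Set UnitAddCircle) ×ˢ K) := isCompact_univ.prod hK
  have := hcomp.induction_on (p := fun S : Set (UnitAddCircle × M) =>
      ∀ᶠ G : SkewProduct n M in c1Nhds g e F, ∀ z ∈ S,
        ∃ k ≥ 1, ∃ ψ : UnitAddCircle, m ^ k • ψ = z.1 ∧ back m G k ψ z.2 ∈ U)
    (by simp) (fun s t hst ht => ht.mono fun G hG z hz => hG z (hst hz))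
    (fun s t hs ht => (hs.and ht).mono fun G hG z hz => hz.elim (hG.1 z) (hG.2 z))
    (fun z hz => ?_)
  · exact this.mono fun G hG φ x hx => hG (φ, x) ⟨trivial, hx⟩
  · obtain ⟨φ, x⟩ := z
    obtain ⟨k, hk, ψ, rfl, hψ⟩ := h φ x hz.2
    obtain ⟨pa, hpa, pb, hpb, hab⟩ := eventually_prod_iff.1
      ((tendsto_back he m F k (ψ, x)).eventually (hU.mem_nhds hψ))
    have hop : IsOpenMap (Prod.map (fun φ : UnitAddCircle => m ^ k • φ) (id : M → M)) :=
      (isOpenMap_pow_nsmul hm k).prodMap IsOpenMap.id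
    have himg := hop.image_mem_nhds (x := (ψ, x)) hpb
    refine ⟨_, mem_nhdsWithin_of_mem_nhds himg, hpa.mono fun G hG => ?_⟩
    rintro _ ⟨⟨ψ', x'⟩, hz', rfl⟩
    exact ⟨k, hk, ψ', rfl, hab hG hz'⟩

end SkewProduct

end Perturbation

/-! ### Robustness of the contraction -/

section Stability

variable {n : ℕ} {M : Type*} [TopologicalSpace M] [ChartedSpace (EuclideanSpace ℝ (Fin n)) M]
  [IsManifold (𝓡 n) ∞ M] {N : ℕ}
  {g : Bundle.ContMDiffRiemannianMetric (𝓡 n) ∞ (EuclideanSpace ℝ (Fin n))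
    (fun x : M => TangentSpace (𝓡 n) x)}
  {e : M → EuclideanSpace ℝ (Fin N)}

namespace AffineChart

theorem contMDiffOn (A : AffineChart g e) (he : ContMDiff (𝓡 n) (𝓡 N) ∞ e) :
    ContMDiffOn (𝓡 n) (𝓡 n) 1 A.q A.q.source := by
  have h1 : ContMDiff (𝓡 n) (𝓡 n) 1 fun x => A.L (e x) - A.b :=
    (A.L.contDiff.sub contDiff_const).contMDiff.comp (he.of_le (by decide))
  exact h1.contMDiffOn.congr A.apply_eq

theorem closedBall_subset_target (A : AffineChart g e) {r : ℝ} (hr : r ≤ 3) :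
    Metric.closedBall 0 r ⊆ A.q.target :=
  (Metric.closedBall_subset_closedBall hr).trans A.closedBall_subset

theorem ball_subset_target (A : AffineChart g e) {r : ℝ} (hr : r ≤ 3) :
    Metric.ball 0 r ⊆ A.q.target :=
  Metric.ball_subset_closedBall.trans (A.closedBall_subset_target hr)

theorem isRegion (A : AffineChart g e) [T2Space M] :
    IsRegion (A.q.symm '' Metric.closedBall 0 1) := by
  refine ⟨A.q.symm '' Metric.ball 0 1, isOpen_symm_image Metric.isOpen_ball
    (A.ball_subset_target (by norm_num)), ?_, Set.Subset.antisymm ?_ ?_⟩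
  · exact ((convex_ball (0 : EuclideanSpace ℝ (Fin n)) 1).isConnected
      ⟨0, Metric.mem_ball_self one_pos⟩).image _
      (A.q.continuousOn_symm.mono (A.ball_subset_target (by norm_num)))
  · rw [← closure_ball (0 : EuclideanSpace ℝ (Fin n)) one_ne_zero]
    refine ContinuousOn.image_closure (A.q.continuousOn_symm.mono ?_)
    rw [closure_ball (0 : EuclideanSpace ℝ (Fin n)) one_ne_zero]
    exact A.closedBall_subset_target (by norm_num)
  · exact closure_minimal (Set.image_mono Metric.ball_subset_closedBall)
      (isCompact_symm_image (isCompact_closedBall _ _)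
        (A.closedBall_subset_target (by norm_num))).isClosed

theorem image_closedBall_ne_univ (A : AffineChart g e) (hn : 1 ≤ n) :
    A.q.symm '' Metric.closedBall 0 1 ≠ Set.univ := by
  have : Nonempty (Fin n) := ⟨⟨0, hn⟩⟩
  obtain ⟨y, hy⟩ := exists_norm_eq (EuclideanSpace ℝ (Fin n)) (zero_le_two (α := ℝ))
  intro h
  obtain ⟨y', hy', heq⟩ := h.symm ▸ Set.mem_univ (A.q.symm y)
  have hyt : y ∈ A.q.target := A.closedBall_subset (by rw [mem_closedBall_zero_iff, hy]; norm_num)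
  have := A.q.symm.injOn (A.closedBall_subset_target (by norm_num) hy') hyt heq
  rw [this, mem_closedBall_zero_iff, hy] at hy'
  norm_num at hy'

/-- The derivatives of two maps `f₁, f₂` in the coordinates of an affine chart differ by at most a
constant times their `C¹` distance. -/
theorem norm_fderiv_sub_le (A : AffineChart g e) (he : ContMDiff (𝓡 n) (𝓡 N) ∞ e)
    {f₁ f₂ : M → M} (hf₁ : ContMDiff (𝓡 n) (𝓡 n) 1 f₁) (hf₂ : ContMDiff (𝓡 n) (𝓡 n) 1 f₂)
    {η : ℝ} (hη : 0 ≤ η) (hd : c1Dist g e f₁ f₂ ≤ ENNReal.ofReal η)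
    {y : EuclideanSpace ℝ (Fin n)} (hy : y ∈ A.q.target) :
    DifferentiableAt ℝ (fun y => A.L (e (f₁ (A.q.symm y))) - A.L (e (f₂ (A.q.symm y)))) y ∧
      ‖fderiv ℝ (fun y => A.L (e (f₁ (A.q.symm y))) - A.L (e (f₂ (A.q.symm y)))) y‖ ≤
        ‖A.L‖ * (η * A.C) := by
  have hqy : MDifferentiableAt (𝓡 n) (𝓡 n) A.q.symm y :=
    (A.contMDiffOn_symm.contMDiffAt (A.q.open_target.mem_nhds hy)).mdifferentiableAt one_ne_zero
  have he1 : ContMDiff (𝓡 n) (𝓡 N) 1 e := he.of_le (by decide)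
  have key : ∀ f : M → M, ContMDiff (𝓡 n) (𝓡 n) 1 f →
      ∃ D : EuclideanSpace ℝ (Fin n) →L[ℝ] EuclideanSpace ℝ (Fin N),
        HasFDerivAt (fun y => e (f (A.q.symm y))) D y ∧
        ∀ w, D w = mvfderiv (𝓡 n) (e ∘ f) (A.q.symm y) (mfderiv (𝓡 n) (𝓡 n) A.q.symm y w) := by
    intro f hf
    have hef : MDifferentiableAt (𝓡 n) (𝓡 N) (e ∘ f) (A.q.symm y) :=
      (he1.comp hf).mdifferentiable one_ne_zero _
    have hcomp : MDifferentiableAt (𝓡 n) (𝓡 N) ((e ∘ f) ∘ A.q.symm) y := hef.comp y hqy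
    have hchain := mfderiv_comp y hef hqy
    refine ⟨fderiv ℝ ((e ∘ f) ∘ A.q.symm) y,
      (mdifferentiableAt_iff_differentiableAt.1 hcomp).hasFDerivAt, fun w => ?_⟩
    rw [← mfderiv_eq_fderiv, hchain]
    rfl
  obtain ⟨D₁, hD₁, hD₁w⟩ := key f₁ hf₁
  obtain ⟨D₂, hD₂, hD₂w⟩ := key f₂ hf₂
  have hder := (A.L.hasFDerivAt.comp y hD₁).sub (A.L.hasFDerivAt.comp y hD₂)
  have hder' : HasFDerivAt (fun y => A.L (e (f₁ (A.q.symm y))) - A.L (e (f₂ (A.q.symm y))))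
    (A.L.comp (D₁ - D₂)) y := by
    rw [ContinuousLinearMap.comp_sub]; exact hder
  refine ⟨hder'.differentiableAt, ?_⟩
  rw [hder'.fderiv]
  refine (ContinuousLinearMap.opNorm_comp_le _ _).trans
    (mul_le_mul_of_nonneg_left ?_ (norm_nonneg _))
  refine ContinuousLinearMap.opNorm_le_bound _ (mul_nonneg hη A.C_pos.le) fun w => ?_
  rcases eq_or_ne w 0 with rfl | hw
  · simp
  set t : ℝ := A.C * ‖w‖ with ht
  have ht0 : 0 < t := mul_pos A.C_pos (norm_pos_iff.2 hw)
  -- the tangent vector represented by `w` is normalized to Riemannian length at most one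
  have h1 : g.inner (A.q.symm y) (mfderiv (𝓡 n) (𝓡 n) A.q.symm y (t⁻¹ • w))
      (mfderiv (𝓡 n) (𝓡 n) A.q.symm y (t⁻¹ • w)) ≤ 1 := by
    refine (A.inner_le y hy (t⁻¹ • w)).trans ?_
    rw [norm_smul, Real.norm_of_nonneg (by positivity), mul_left_comm, ← ht,
      inv_mul_cancel₀ ht0.ne', one_pow]
  have h2 := (SkewProduct.edist_mvfderiv_le_c1Dist (e := e) f₁ f₂ _ _ h1).trans hd
  rw [← hD₁w, ← hD₂w, edist_dist, dist_eq_norm] at h2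
  have h3 := (ENNReal.ofReal_le_ofReal_iff hη).1 h2
  rw [map_smul, map_smul, ← smul_sub, norm_smul, Real.norm_of_nonneg (by positivity),
    inv_mul_le_iff₀ ht0] at h3
  rw [sub_apply]
  rw [ht] at h3
  linarith

/-- In the coordinates of an affine chart, a perturbation of a contraction is a contraction. -/
theorem norm_apply_sub_le (A : AffineChart g e) (he : ContMDiff (𝓡 n) (𝓡 N) ∞ e)
    {f₁ f₂ : M → M} (hf₁ : ContMDiff (𝓡 n) (𝓡 n) 1 f₁) (hf₂ : ContMDiff (𝓡 n) (𝓡 n) 1 f₂)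
    {η : ℝ} (hη : 0 ≤ η) (hd : c1Dist g e f₁ f₂ ≤ ENNReal.ofReal η) {lam : ℝ}
    (h₁ : ∀ x ∈ A.q.symm '' Metric.closedBall 0 1, f₁ x ∈ A.q.source)
    (h₂ : ∀ x ∈ A.q.symm '' Metric.closedBall 0 1, f₂ x ∈ A.q.source)
    (hlam : ∀ x ∈ A.q.symm '' Metric.closedBall 0 1, ∀ x' ∈ A.q.symm '' Metric.closedBall 0 1,
      ‖A.q (f₂ x) - A.q (f₂ x')‖ ≤ lam * ‖A.q x - A.q x'‖) :
    ∀ x ∈ A.q.symm '' Metric.closedBall 0 1, ∀ x' ∈ A.q.symm '' Metric.closedBall 0 1,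
      ‖A.q (f₁ x) - A.q (f₁ x')‖ ≤ (lam + ‖A.L‖ * (η * A.C)) * ‖A.q x - A.q x'‖ := by
  intro x hx x' hx'
  have h4 := hlam x hx x' hx'
  have e1 := h₁ x hx
  have e2 := h₂ x hx
  have e3 := h₁ x' hx'
  have e4 := h₂ x' hx'
  obtain ⟨y, hy, rfl⟩ := hx
  obtain ⟨y', hy', rfl⟩ := hx'
  have hyt : ∀ y ∈ Metric.closedBall (0 : EuclideanSpace ℝ (Fin n)) 1, y ∈ A.q.target :=
    fun y hy => A.closedBall_subset_target (by norm_num) hy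
  have hmv := (convex_closedBall
    (0 : EuclideanSpace ℝ (Fin n)) 1).norm_image_sub_le_of_norm_fderiv_le
    (fun y hy => (A.norm_fderiv_sub_le he hf₁ hf₂ hη hd (hyt y hy)).1)
    (fun y hy => (A.norm_fderiv_sub_le he hf₁ hf₂ hη hd (hyt y hy)).2) hy' hy
  rw [A.q.right_inv (hyt y hy), A.q.right_inv (hyt y' hy')] at h4 ⊢
  rw [A.apply_eq _ e2, A.apply_eq _ e4] at h4
  rw [A.apply_eq _ e1, A.apply_eq _ e3]
  set a := A.L (e (f₁ (A.q.symm y)))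
  set a' := A.L (e (f₁ (A.q.symm y')))
  set b := A.L (e (f₂ (A.q.symm y)))
  set b' := A.L (e (f₂ (A.q.symm y')))
  have : a - A.b - (a' - A.b) = (b - A.b - (b' - A.b)) + (a - b - (a' - b')) := by abel
  rw [this, add_mul]
  exact (norm_add_le _ _).trans (add_le_add h4 hmv)

/-- A skew product which contracts the coordinates of an affine chart on the unit ball shrinks the
fibers uniformly. -/
theorem isContractingSkew [CompactSpace M] [T2Space M] (A : AffineChart g e) {m : ℕ} (hm : 2 ≤ m)
    {G : SkewProduct n M} {lam : ℝ} (hlam0 : 0 ≤ lam) (hlam1 : lam < 1)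
    (hmaps : ∀ φ, ∀ x ∈ A.q.symm '' Metric.closedBall 0 1,
      G.fiber φ x ∈ A.q.symm '' Metric.ball 0 1)
    (hlam : ∀ φ, ∀ x ∈ A.q.symm '' Metric.closedBall 0 1,
      ∀ x' ∈ A.q.symm '' Metric.closedBall 0 1,
      ‖A.q (G.fiber φ x) - A.q (G.fiber φ x')‖ ≤ lam * ‖A.q x - A.q x'‖) :
    IsContractingSkew m (G.toMap m) (A.q.symm '' Metric.closedBall 0 1) := by
  set B := A.q.symm '' Metric.closedBall 0 1 with hB
  have hballB : A.q.symm '' Metric.ball 0 1 ⊆ B := Set.image_mono Metric.ball_subset_closedBall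
  have hqB : ∀ x ∈ B, ‖A.q x‖ ≤ 1 ∧ A.q.symm (A.q x) = x := by
    rintro _ ⟨y, hy, rfl⟩
    have hyt := A.closedBall_subset_target (by norm_num) hy
    rw [A.q.right_inv hyt]
    exact ⟨by simpa using hy, rfl⟩
  refine ⟨G.continuous_toMap m, G.isOpenMap_toMap hm, fun p => rfl,
    isCompact_symm_image (isCompact_closedBall _ _) (A.closedBall_subset_target (by norm_num)),
    fun p hp => interior_maximal hballB (isOpen_symm_image Metric.isOpen_ball
      (A.ball_subset_target (by norm_num))) (hmaps p.1 p.2 hp), fun f ε hε => ?_⟩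
  have hcont : ContinuousOn (fun z : UnitAddCircle × EuclideanSpace ℝ (Fin n) =>
      f (z.1, A.q.symm z.2)) (Set.univ ×ˢ Metric.closedBall 0 1) := by
    refine f.continuous.comp_continuousOn (continuousOn_fst.prodMk ?_)
    exact (A.q.continuousOn_symm.mono (A.closedBall_subset_target (by norm_num))).comp
      continuousOn_snd fun z hz => hz.2
  have hunif := (isCompact_univ.prod (isCompact_closedBall (0 : EuclideanSpace ℝ (Fin n))
    1)).uniformContinuousOn_of_continuous hcont
  obtain ⟨δ, hδ, hδf⟩ := Metric.uniformContinuousOn_iff.1 hunif ε hε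
  have hpow : Tendsto (fun k : ℕ => lam ^ k * 2) atTop (𝓝 0) := by
    simpa using (tendsto_pow_atTop_nhds_zero_of_lt_one hlam0 hlam1).mul_const 2
  obtain ⟨k₀, hk₀⟩ := eventually_atTop.1 (hpow.eventually (Iio_mem_nhds hδ))
  have hiter : ∀ (k : ℕ) (φ : UnitAddCircle), ∀ x ∈ B, ∀ x' ∈ B,
      ((G.toMap m)^[k] (φ, x)).1 = ((G.toMap m)^[k] (φ, x')).1 ∧
      ((G.toMap m)^[k] (φ, x)).2 ∈ B ∧ ((G.toMap m)^[k] (φ, x')).2 ∈ B ∧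
      ‖A.q ((G.toMap m)^[k] (φ, x)).2 - A.q ((G.toMap m)^[k] (φ, x')).2‖ ≤ lam ^ k * 2 := by
    intro k φ x hx x' hx'
    induction k with
    | zero =>
      refine ⟨rfl, hx, hx', ?_⟩
      have h1 := (hqB x hx).1
      have h2 := (hqB x' hx').1
      simp only [Function.iterate_zero, id_eq, pow_zero, one_mul]
      exact (norm_sub_le _ _).trans (by linarith)
    | succ k ih =>
      obtain ⟨h1, h2, h3, h4⟩ := ih
      simp only [Function.iterate_succ_apply']
      set p := (G.toMap m)^[k] (φ, x)
      set p' := (G.toMap m)^[k] (φ, x')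
      refine ⟨by simp [SkewProduct.toMap, h1], hballB (hmaps _ _ h2), hballB (hmaps _ _ h3), ?_⟩
      have h5 := hlam p.1 p.2 h2 p'.2 h3
      have h6 : (G.toMap m p').2 = G.fiber p.1 p'.2 := by rw [h1]; rfl
      rw [h6, pow_succ', mul_assoc]
      exact h5.trans (mul_le_mul_of_nonneg_left h4 hlam0)
  refine ⟨k₀, fun k hk φ x hx x' hx' => ?_⟩
  obtain ⟨h1, h2, h3, h4⟩ := hiter k φ x hx x' hx'
  set p := (G.toMap m)^[k] (φ, x)
  set p' := (G.toMap m)^[k] (φ, x')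
  have h5 := hδf (p.1, A.q p.2) ⟨trivial, by simpa using (hqB _ h2).1⟩ (p'.1, A.q p'.2)
    ⟨trivial, by simpa using (hqB _ h3).1⟩ (by
      rw [h1, Prod.dist_eq, dist_self, dist_eq_norm]
      exact max_lt hδ (h4.trans_lt (hk₀ k hk)))
  simp only [(hqB _ h2).2, (hqB _ h3).2] at h5
  exact (Real.dist_eq _ _ ▸ h5.le :)

end AffineChart

end Stability

/-! ### An open set of skew products with massive attractors -/

section Model

variable {n : ℕ} {M : Type*} [TopologicalSpace M] [ChartedSpace (EuclideanSpace ℝ (Fin n)) M]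

/-- Backward orbits of a skew product given by `push` in the coordinates `q` are backward orbits of
`push`. -/
theorem SkewProduct.exists_back_eq
    {q : OpenPartialHomeomorph M (EuclideanSpace ℝ (Fin n))} {m : ℕ} {F : SkewProduct n M} {ε : ℝ}
    {c : UnitAddCircle → EuclideanSpace ℝ (Fin n)}
    (hF : ∀ φ, ∀ y ∈ q.target, F.fiber φ (q.symm y) = q.symm (push ε (c φ) y) ∧
      ∃ y' ∈ q.target, push ε (c φ) y' = y)
    (k : ℕ) (ψ : UnitAddCircle) {y : EuclideanSpace ℝ (Fin n)} (hy : y ∈ q.target) :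
    ∃ x : ℕ → EuclideanSpace ℝ (Fin n), x k = y ∧
      (∀ j < k, x (j + 1) = push ε (c (m ^ j • ψ)) (x j)) ∧ x 0 ∈ q.target ∧
      F.back m k ψ (q.symm y) = q.symm (x 0) := by
  induction k generalizing ψ with
  | zero => exact ⟨fun _ => y, rfl, by simp, hy, rfl⟩
  | succ k ih =>
    obtain ⟨x, hxk, hx, hx0, hback⟩ := ih (m • ψ)
    obtain ⟨x₀, hx₀, hpush⟩ := (hF ψ (x 0) hx0).2
    refine ⟨fun j => Nat.casesOn j x₀ x, hxk, ?_, hx₀, ?_⟩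
    · rintro (_ | j) hj
      · simp [hpush]
      · have := hx j (by omega)
        simpa [pow_succ, mul_smul] using this
    · rw [SkewProduct.back, hback, ← hpush, ← (hF ψ x₀ hx₀).1]
      exact (F.fiber ψ).symm_apply_apply _

variable [IsManifold (𝓡 n) ∞ M] {N : ℕ}
  {g : Bundle.ContMDiffRiemannianMetric (𝓡 n) ∞ (EuclideanSpace ℝ (Fin n))
    (fun x : M => TangentSpace (𝓡 n) x)}
  {e : M → EuclideanSpace ℝ (Fin N)}

/-- All small perturbations of the skew product given by `push` in an affine chart shrink the
fibers over the unit ball of the chart. -/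
theorem AffineChart.eventually_isContractingSkew [CompactSpace M] [T2Space M]
    (A : AffineChart g e) (he : ContMDiff (𝓡 n) (𝓡 N) ∞ e) (he_ind : IsInducing e)
    {m : ℕ} (hm : 2 ≤ m) {F : SkewProduct n M} {ε : ℝ} (hε : 0 < ε) (hε1 : ε < 1)
    {c : UnitAddCircle → EuclideanSpace ℝ (Fin n)} (hc : ∀ φ, ‖c φ‖ ≤ 1 / 2)
    (hF : ∀ φ, ∀ y ∈ A.q.target, F.fiber φ (A.q.symm y) = A.q.symm (push ε (c φ) y)) :
    ∀ᶠ G in SkewProduct.c1Nhds g e F,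
      IsContractingSkew m (G.toMap m) (A.q.symm '' Metric.closedBall 0 1) := by
  have hsub := A.closedBall_subset_target (r := 1) (by norm_num)
  have hball : A.q.symm '' Metric.ball 0 1 ⊆ A.q.source := by
    rintro _ ⟨y, hy, rfl⟩
    exact A.q.map_target (hsub (Metric.ball_subset_closedBall hy))
  have hFmaps : ∀ φ, ∀ x ∈ A.q.symm '' Metric.closedBall 0 1,
      F.fiber φ x ∈ A.q.symm '' Metric.ball 0 1 := by
    rintro φ _ ⟨y, hy, rfl⟩
    rw [hF φ y (hsub hy)]
    exact ⟨_, by simpa using norm_push_lt_one hε hε1.le (hc φ) (by simpa using hy), rfl⟩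
  have hFlam : ∀ φ, ∀ x ∈ A.q.symm '' Metric.closedBall 0 1,
      ∀ x' ∈ A.q.symm '' Metric.closedBall 0 1,
      ‖A.q (F.fiber φ x) - A.q (F.fiber φ x')‖ ≤ (1 - ε) * ‖A.q x - A.q x'‖ := by
    rintro φ _ ⟨y, hy, rfl⟩ _ ⟨y', hy', rfl⟩
    have key : ∀ y ∈ Metric.closedBall (0 : EuclideanSpace ℝ (Fin n)) 1,
        A.q (A.q.symm y) = y ∧ A.q (F.fiber φ (A.q.symm y)) = (1 - ε) • y + ε • c φ := by
      intro y hy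
      have hy1 : ‖y‖ ≤ 1 := by simpa using hy
      refine ⟨A.q.right_inv (hsub hy), ?_⟩
      rw [hF φ y (hsub hy), A.q.right_inv, push_of_norm_le_one ε _ hy1]
      exact hsub (by simpa using (norm_push_lt_one hε hε1.le (hc φ) hy1).le)
    rw [(key y hy).1, (key y' hy').1, (key y hy).2, (key y' hy').2, add_sub_add_right_eq_sub,
      ← smul_sub, norm_smul, Real.norm_of_nonneg (by linarith)]
  -- a distance for which the contraction constant `1 - ε` of `F` grows to at most `1 - ε / 2`
  set η : ℝ := ε / (2 * ((‖A.L‖ + 1) * A.C)) with hη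
  have hC := A.C_pos
  have hη0 : 0 < η := by positivity
  have hηle : ‖A.L‖ * (η * A.C) ≤ ε / 2 := by
    have : (‖A.L‖ + 1) * (η * A.C) = ε / 2 := by
      rw [hη]
      have := norm_nonneg A.L
      field_simp
    nlinarith [mul_pos hη0 hC]
  have hdist : ∀ᶠ G in SkewProduct.c1Nhds g e F,
      SkewProduct.c1Edist g e G F < ENNReal.ofReal η :=
    (SkewProduct.tendsto_c1Edist F).eventually (Iio_mem_nhds (ENNReal.ofReal_pos.2 hη0))
  filter_upwards [hdist, SkewProduct.eventually_fiber_mem he_ind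
    (isCompact_symm_image (isCompact_closedBall _ _) hsub)
    (isOpen_symm_image Metric.isOpen_ball (A.ball_subset_target (by norm_num))) hFmaps]
    with G hG hGmaps
  have hnonneg : 0 ≤ ‖A.L‖ * (η * A.C) := by positivity
  refine A.isContractingSkew hm (lam := (1 - ε) + ‖A.L‖ * (η * A.C)) (by linarith) (by linarith)
    hGmaps fun φ => ?_
  exact A.norm_apply_sub_le he (G.fiber φ).contMDiff_toFun (F.fiber φ).contMDiff_toFun hη0.le
    ((SkewProduct.c1Dist_fiber_le F G φ).trans hG.le) (fun x hx => hball (hGmaps φ x hx))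
    (fun x hx => hball (hFmaps φ x hx)) (hFlam φ)

/-- There is a skew product all of whose small perturbations have a massive attractor. -/
theorem exists_eventually_hasMassiveAttractor [CompactSpace M] [T2Space M] [Nonempty M]
    [MeasurableSpace M] [BorelSpace M] {m : ℕ} (hm : 2 ≤ m) (hn : 1 ≤ n)
    (g : Bundle.ContMDiffRiemannianMetric (𝓡 n) ∞ (EuclideanSpace ℝ (Fin n))
      (fun x : M => TangentSpace (𝓡 n) x))
    (he : ContMDiff (𝓡 n) (𝓡 N) ∞ e) (he_inj : Function.Injective e)
    (he_imm : ∀ x : M, Function.Injective (mfderiv (𝓡 n) (𝓡 N) e x)) :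
    ∃ F : SkewProduct n M,
      ∀ᶠ G in SkewProduct.c1Nhds g e F, HasMassiveAttractor n (G.toMap m) := by
  have hemb : IsEmbedding e := (he.continuous.isClosedEmbedding he_inj).isEmbedding
  have : SecondCountableTopology M := hemb.secondCountableTopology
  obtain ⟨A⟩ := nonempty_affineChart g he he_imm
  obtain ⟨c, hc, hmean, hspan⟩ := exists_meanZero_curve hm n
  obtain ⟨r, hr0, hr1, ε₁, hε₁, hε₁r, hcov⟩ := exists_push_covering hm c.continuous hc hmean hspan
  obtain ⟨ε₂, hε₂, hhomeo⟩ := exists_push_homeomorph (EuclideanSpace ℝ (Fin n))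
  set ε := min ε₁ ε₂
  have hε : 0 < ε := lt_min hε₁ hε₂
  have hεr : ε < r := (min_le_left _ _).trans_lt hε₁r
  obtain ⟨F, hF⟩ := exists_skewProduct_push A.closedBall_subset (A.contMDiffOn he)
    A.contMDiffOn_symm (ε := ε) c.continuous fun φ => hhomeo ε hε (min_le_right _ _) _ (hc φ)
  set W := A.q.symm '' Metric.ball 0 r with hW
  have hr3 : r ≤ 3 := by linarith
  have hWo : IsOpen W := isOpen_symm_image Metric.isOpen_ball (A.ball_subset_target hr3)
  have h0 : (0 : EuclideanSpace ℝ (Fin n)) ∈ A.q.target :=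
    A.ball_subset_target hr3 (Metric.mem_ball_self hr0)
  have hF0 : ∀ φ, ∀ x ∈ ({A.q.symm 0} : Set M), F.fiber φ x ∈ W := by
    rintro φ _ rfl
    rw [(hF φ 0 h0).1, push_of_norm_le_one ε _ (by simp)]
    refine ⟨_, ?_, rfl⟩
    rw [smul_zero, zero_add, mem_ball_zero_iff, norm_smul, Real.norm_of_nonneg hε.le]
    nlinarith [hc φ]
  have hFcov : ∀ φ, ∀ x ∈ A.q.symm '' Metric.closedBall 0 r,
      ∃ k ≥ 1, ∃ ψ, m ^ k • ψ = φ ∧ F.back m k ψ x ∈ W := by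
    rintro φ _ ⟨y, hy, rfl⟩
    obtain ⟨k, hk, ψ, hψ, hx⟩ := hcov ε hε (min_le_left _ _) φ y (by simpa using hy)
    obtain ⟨x, hxk, hxj, -, hback⟩ :=
      SkewProduct.exists_back_eq (m := m) hF k ψ (A.closedBall_subset_target hr3 hy)
    exact ⟨k, hk, ψ, hψ, hback ▸ ⟨_, by simpa using hx x hxj hxk, rfl⟩⟩
  refine ⟨F, ?_⟩
  filter_upwards [A.eventually_isContractingSkew he hemb.isInducing hm hε (hεr.trans hr1) hc
      fun φ y hy => (hF φ y hy).1,
    SkewProduct.eventually_fiber_mem hemb.isInducing isCompact_singleton hWo hF0,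
    SkewProduct.eventually_exists_back_mem hemb.isInducing hm
      (isCompact_symm_image (isCompact_closedBall _ _) (A.closedBall_subset_target hr3)) hWo hFcov]
    with G hG hG0 hGcov
  refine hG.hasMassiveAttractor hm A.isRegion (A.image_closedBall_ne_univ hn) hWo
    (((convex_ball (0 : EuclideanSpace ℝ (Fin n)) r).isConnected
      ⟨0, Metric.mem_ball_self hr0⟩).image _
        (A.q.continuousOn_symm.mono (A.ball_subset_target hr3)))
    (Set.image_mono (Metric.ball_subset_closedBall.trans
      (Metric.closedBall_subset_closedBall hr1.le))) ?_
    ⟨(0, A.q.symm 0), ⟨0, Metric.mem_ball_self hr0, rfl⟩, hG0 0 _ rfl⟩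
  rintro ⟨φ, x⟩ hx
  obtain ⟨k, hk, ψ, hψ, hback⟩ := hGcov φ x (Set.image_mono Metric.ball_subset_closedBall hx)
  exact ⟨k, hk, (ψ, G.back m k ψ x), hback, by rw [G.iterate_toMap_back, hψ]⟩

end Model

end MassiveAttractor

theorem theorem2 (m : ℕ) (hm : 3 ≤ m) (n : ℕ) (hn : 1 ≤ n)
    {M : Type*} [TopologicalSpace M] [ChartedSpace (EuclideanSpace ℝ (Fin n)) M]
    [IsManifold (𝓡 n) ∞ M] [CompactSpace M] [T2Space M] [Nonempty M]
    [MeasurableSpace M] [BorelSpace M]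
    (g : Bundle.ContMDiffRiemannianMetric (𝓡 n) ∞ (EuclideanSpace ℝ (Fin n))
      (fun x : M => TangentSpace (𝓡 n) x))
    {N : ℕ} (e : M → EuclideanSpace ℝ (Fin N))
    (he : ContMDiff (𝓡 n) (𝓡 N) ∞ e) (he_inj : Function.Injective e)
    (he_imm : ∀ x : M, Function.Injective (mfderiv (𝓡 n) (𝓡 N) e x)) :
    ∃ O : Set (MassiveAttractor.SkewProduct n M),
      IsOpen[MassiveAttractor.SkewProduct.c1Topology g e] O ∧ O.Nonempty ∧
      ∀ F ∈ O, MassiveAttractor.HasMassiveAttractor n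
        (MassiveAttractor.SkewProduct.toMap m F) := by
  obtain ⟨F, hF⟩ := MassiveAttractor.exists_eventually_hasMassiveAttractor (m := m) (by omega) hn g
    he he_inj he_imm
  obtain ⟨O, hO, hOo, hFO⟩ :=
    (@mem_nhds_iff _ (MassiveAttractor.SkewProduct.c1Topology g e) F _).1 hF
  exact ⟨O, hOo, ⟨F, hFO⟩, hO⟩
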